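/- Let $D\subset\mathbb{C}^n$ be a bounded domain, $\varphi\in C^2(D)$ real-valued, and $r$ an integer with $1\le r\le n$. $dV$ is Lebesgue measure, $A^2(D,\varphi)$ is the set of holomorphic $f$ on $D$ with $\int_D|f|^2e^{-\varphi}dV<\infty$, and $\|h\|_{\varphi}^2=\int_D\sum_i|h_i|^2e^{-\varphi}dV$. For $g=(g_1,\dots,g_{r+1})\in\mathcal{O}(D)^{r+1}$ without common zeros put $|g|^2=\sum_i|g_i|^2$, let $$\beta=|g|^2\Big(-\partial\big(\tfrac{g_1}{|g|^2}\big),\dots,-\partial\big(\tfrac{g_{r+1}}{|g|^2}\big)\Big),\qquad \beta^*=\Big(-\bar\partial\big(\tfrac{\bar g_1}{|g|^2}\big),\dots,-\bar\partial\big(\tfrac{\bar g_{r+1}}{|g|^2}\big)\Big)$$ be the second fundamental form of $S=\operatorname{Ker}g\subset\underline{\mathbb{C}}^{r+1}$ and its adjoint, and write $\beta=\sum\beta_{j\lambda}\,dz_j$ and $\beta^*=\sum\beta^*_{k\mu}\,d\bar z_k$ in components $\lambda,\mu$. For a smooth plurisubharmonic $\psi$ on $D$, $$i\partial\bar\partial\psi\otimes\mathrm{Id}+i\beta^*\wedge\beta=i\sum_{j,k,\lambda,\mu}c_{jk\lambda\mu}\,dz_j\wedge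 d\bar z_k\otimes e_\lambda^*\otimes e_\mu,\qquad c_{jk\lambda\mu}=\frac{\partial^2\psi}{\partial z_j\partial\bar z_k}\delta_{\lambda\mu}-\beta^*_{k\mu}\beta_{j\lambda}.$$ It is positive in the sense of Nakano if $\sum c_{jk\lambda\mu}u_{j\lambda}\bar u_{k\mu}>0$ for all $u\ne0$, at every point of $D$. Let $\Lambda$ be the adjoint of multiplication by the standard Euclidean Kähler form $\omega$, for which the $dz_j$ are orthonormal; on $(n,1)$-forms $u=\sum u_{j\lambda}\,dz\wedge d\bar z_j\otimes e_\lambda$, with $dz=dz_1\wedge\dots\wedge dz_n$, one has $\langle[i\partial\bar\partial\psi\otimes\mathrm{Id}+i\beta^*\wedge\beta,\Lambda]u,u\rangle=\sum c_{jk\lambda\mu}u_{j\lambda}\bar u_{k\mu}$. Put $$I_{\varphi,\psi,g}(f)=\int_D\Big\{\frac1{|g|^2}+\Big\langle\big[i\partial\bar\partial\psi\otimes\mathrm{Id}+i\beta^*\wedge\beta,\Lambda\big]^{-1}\beta^*\wedge dz,\ \beta^*\wedge dz\Big\rangle\Big\}|f|^2e^{-\varphi-\psi}\,dV.$$ **Theorem.**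 Suppose there is a non-zero $f\in A^2(D,\varphi)$ with the following property: for every $g=(g_1,\dots,g_{r+1})\in\mathcal{O}(D)^{r+1}$ without common zeros in $D$ and with $dg_1\wedge\dots\wedge dg_r\neq0$ at every point of $D$, and every smooth plurisubharmonic function $\psi$ on $D$ such that $i\partial\bar\partial\psi\otimes\mathrm{Id}+i\beta^*\wedge\beta$ is positive in the sense of Nakano on $D$ and $I_{\varphi,\psi,g}(f)<\infty$, there is $h=(h_1,\dots,h_{r+1})\in\mathcal{O}(D)^{r+1}$ with $f=g_1h_1+\dots+g_{r+1}h_{r+1}$ and $$\|h\|^2_{\varphi+\psi}\le I_{\varphi,\psi,g}(f).$$ Then, at every point of $D$, the sum of any $r$ eigenvalues (counted with multiplicity) of $i\partial\bar\partial\varphi$, that is, of the Hermitian matrix $\big(\partial^2\varphi/\partial z_j\partial\bar z_k\big)_{j,k}$, is non-negative. -/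

import Mathlib

open scoped ContDiff ENNReal

noncomputable section

namespace SkodaConverse

/-- The Wirtinger derivative `∂F/∂z_j = ½ (∂F/∂x_j - i ∂F/∂y_j)`. -/
def dz {n : ℕ} (j : Fin n) (F : (Fin n → ℂ) → ℂ) (z : Fin n → ℂ) : ℂ :=
  (1 / 2) * (fderiv ℝ F z (Pi.single j 1) - Complex.I * fderiv ℝ F z (Pi.single j Complex.I))

/-- The Wirtinger derivative `∂F/∂z̄_j = ½ (∂F/∂x_j + i ∂F/∂y_j)`. -/
def dzbar {n : ℕ} (j : Fin n) (F : (Fin n → ℂ) → ℂ) (z : Fin n → ℂ) : ℂ :=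
  (1 / 2) * (fderiv ℝ F z (Pi.single j 1) + Complex.I * fderiv ℝ F z (Pi.single j Complex.I))

/-- The complex Hessian `(∂²u/∂z_j∂z̄_k)_{j,k}` of a real function: the matrix of `i∂∂̄u`
with respect to the standard Euclidean metric of `ℂⁿ`. -/
def complexHessian {n : ℕ} (u : (Fin n → ℂ) → ℝ) (z : Fin n → ℂ) : Matrix (Fin n) (Fin n) ℂ :=
  Matrix.of fun j k => dz j (dzbar k (fun w => (u w : ℂ))) z

/-- A real-valued function is plurisubharmonic on `D`: it is upper semicontinuous, and on every
closed affine complex disc contained in `D` its value at the centre is at most its mean over the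
boundary circle. -/
def PSH {n : ℕ} (D : Set (Fin n → ℂ)) (u : (Fin n → ℂ) → ℝ) : Prop :=
  UpperSemicontinuousOn u D ∧
    ∀ a b : Fin n → ℂ, (∀ ζ : ℂ, ‖ζ‖ ≤ 1 → a + ζ • b ∈ D) →
      u a ≤ Real.circleAverage (fun ζ : ℂ => u (a + ζ • b)) 0 1

/-- `|v|² = |v_1|² + ⋯ + |v_k|²`. -/
def sqNorm {k : ℕ} (v : Fin k → ℂ) : ℝ := ∑ l, ‖v l‖ ^ 2

/-- The coefficients `c_{jkλμ}` at a point of a `(1,1)`-form with values in `End(ℂᵏ)`,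
`i ∑ c_{jkλμ} dz_j ∧ dz̄_k ⊗ e_λ^* ⊗ e_μ`. -/
abbrev Coeffs (n k : ℕ) := Fin n → Fin n → Fin k → Fin k → ℂ

/-- The associated form on `T ⊗ ℂᵏ`, `θ(u, u) = ∑ c_{jkλμ} u_{jλ} conj(u_{kμ})`. -/
def nakanoForm {n k : ℕ} (c : Coeffs n k) (u : Fin n → Fin k → ℂ) : ℂ :=
  ∑ j, ∑ m, ∑ l, ∑ p, c j m l p * u j l * star (u m p)

/-- Positivity in the sense of Nakano at a point: the form is positive definite. -/
def NakanoPositive {n k : ℕ} (c : Coeffs n k) : Prop :=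
  ∀ u : Fin n → Fin k → ℂ, u ≠ 0 → 0 < (nakanoForm c u).re

/-- The operator `[i ∑ c_{jkλμ} dz_j ∧ dz̄_k ⊗ e_λ^* ⊗ e_μ, Λ]` on `ℂᵏ`-valued `(n,1)`-forms, as a
matrix in the orthonormal frame `dz ∧ dz̄_j ⊗ e_λ`. It is the operator `B` with
`⟨B u, u⟩ = ∑ c_{jkλμ} u_{jλ} conj(u_{kμ})`, that is, `(B u)_{mp} = ∑_{j,l} c_{jmlp} u_{jl}`. -/
def commLambda {n k : ℕ} (c : Coeffs n k) : Matrix (Fin n × Fin k) (Fin n × Fin k) ℂ :=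
  Matrix.of fun x y => c y.1 x.1 y.2 x.2

/-- The coefficient of `dz_j` in the `l`-th component of the second fundamental form
`β = |g|² (-∂(g_1/|g|²), …, -∂(g_k/|g|²))` of `S = Ker g`. -/
def beta {n k : ℕ} (g : Fin k → (Fin n → ℂ) → ℂ) (z : Fin n → ℂ) (j : Fin n) (l : Fin k) : ℂ :=
  -((sqNorm fun i => g i z : ℝ) : ℂ) *
    dz j (fun w => g l w / ((sqNorm fun i => g i w : ℝ) : ℂ)) z

/-- The coefficient of `dz̄_j` in the `l`-th component of `β^* = -∂̄ g^*`, with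
`g^* = (conj(g_1)/|g|², …, conj(g_k)/|g|²)`. This is `conj(β_{jl})/|g|²`, so that `β^*` is the
adjoint of `β`, the target line bundle of `g` carrying the quotient metric `|q|²/|g|²`. -/
def betaStar {n k : ℕ} (g : Fin k → (Fin n → ℂ) → ℂ) (z : Fin n → ℂ) (j : Fin n) (l : Fin k) :
    ℂ :=
  -dzbar j (fun w => star (g l w) / ((sqNorm fun i => g i w : ℝ) : ℂ)) z

/-- The coefficients of `i∂∂̄ψ ⊗ Id + i β^* ∧ β`, where
`β^* ∧ β = -∑ dz_j ∧ dz̄_m ⊗ β_m^* β_j`. -/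
def curv {n k : ℕ} (ψ : (Fin n → ℂ) → ℝ) (g : Fin k → (Fin n → ℂ) → ℂ) (z : Fin n → ℂ) :
    Coeffs n k :=
  fun j m l p => (if l = p then complexHessian ψ z j m else 0) - betaStar g z m p * beta g z j l

/-- `([i∂∂̄ψ ⊗ Id + i β^* ∧ β, Λ]⁻¹ β^* ∧ dz, β^* ∧ dz)` at the point `z`. -/
def curvTerm {n k : ℕ} (ψ : (Fin n → ℂ) → ℝ) (g : Fin k → (Fin n → ℂ) → ℂ) (z : Fin n → ℂ) : ℝ :=
  let b : Fin n × Fin k → ℂ := fun x => betaStar g z x.1 x.2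
  (((commLambda (curv ψ g z))⁻¹.mulVec b) ⬝ᵥ star b).re

/-- `‖h‖²_φ = ∫_D |h|² e^{-φ} dV`. -/
def normSq {n k : ℕ} (D : Set (Fin n → ℂ)) (φ : (Fin n → ℂ) → ℝ)
    (h : Fin k → (Fin n → ℂ) → ℂ) : ℝ≥0∞ :=
  ∫⁻ z in D, ENNReal.ofReal (sqNorm (fun i => h i z) * Real.exp (-φ z))

/-- `I_{φ,ψ,g}(f) = ∫_D {1/|g|² + ([i∂∂̄ψ ⊗ Id + iβ^*∧β, Λ]⁻¹ β^*∧dz, β^*∧dz)} |f|² e^{-φ-ψ} dV`. -/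
def skodaI {n k : ℕ} (D : Set (Fin n → ℂ)) (φ ψ : (Fin n → ℂ) → ℝ)
    (g : Fin k → (Fin n → ℂ) → ℂ) (f : (Fin n → ℂ) → ℂ) : ℝ≥0∞ :=
  ∫⁻ z in D, ENNReal.ofReal
    ((1 / sqNorm (fun i => g i z) + curvTerm ψ g z) * ‖f z‖ ^ 2 * Real.exp (-φ z - ψ z))

/-- `f ∈ A²(D, φ)`. -/
def MemA2 {n : ℕ} (D : Set (Fin n → ℂ)) (φ : (Fin n → ℂ) → ℝ) (f : (Fin n → ℂ) → ℂ) : Prop :=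
  DifferentiableOn ℂ f D ∧ ∫⁻ z in D, ENNReal.ofReal (‖f z‖ ^ 2 * Real.exp (-φ z)) < ⊤

/-- The value of `dg_1 ∧ ⋯ ∧ dg_r` at `z` on the tangent vectors `v_1, …, v_r`. -/
def wedgeD {n r : ℕ} (g : Fin r → (Fin n → ℂ) → ℂ) (z : Fin n → ℂ) (v : Fin r → Fin n → ℂ) : ℂ :=
  Matrix.det (Matrix.of fun i j => fderiv ℂ (g i) z (v j))

end SkodaConverse

end

noncomputable section

namespace SkodaConverse

open MeasureTheory Complex

/-! The argument converts the division estimate into a Hörmander-type estimate for `∂̄` and then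
localises it at a point `p` with Gaussian weights. Fix an orthonormal `r`-frame `a_1, …, a_r` and
apply the hypothesis to `g = (c⟨z-p,a_1⟩, …, c⟨z-p,a_r⟩, 1)` and `ψ = s|z-p|²` with `c²r < s`. The
curvature operator is then `s Id` minus a rank-one operator of norm at most `c²r`, so the curvature
term in `I` is at most `c²r/(s-c²r)`.

By Pythagoras `|h|²` exceeds `|f|²/|g|²` by at least `∑ |h_l - c f conj⟨z-p,a_l⟩/|g|²|²`. The terms
`|f|²/|g|²` cancel and a factor `c²` divides out. The `h_l` are holomorphic, hence orthogonal to
every `e^u ∂_a(α e^{-u})` with `α` compactly supported; testing against these removes `h`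
(`SkodaDivision.test_inequality`). As `c → 0` what remains is the dual form of an `L²` estimate with
constant `r/s` for the equations `∂̄_{a_l} v_l = f` (`SkodaDivision.limit_inequality`).

Take `α = χf` with a cut-off `χ` and use the Bochner–Kodaira identity
(`integral_norm_twistedDz_sq`). The terms of order `s` form the square `rs(1-χ)²`, and `∫ (rs(1-χ)²
+ χ² ∑ L_φ(a_l) + ∑ |∂̄_{a_l}χ|²) |f|² e^{-φ-s|z-p|²} ≥ 0`, where `L_φ` is the Levi form
(`SkodaDivision.integral_cutoff_nonneg`). If `∑ L_φ(a_l)` were negative near `p`, the first and last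
terms would live away from `p` and be exponentially smaller than the negative middle one as `s → ∞`,
a contradiction (`SkodaDivision.sum_leviForm_nonneg`). A frame of conjugated eigenvectors at `p`
gives the theorem. -/

/-- The Wirtinger derivative `∑ a_j ∂F/∂z_j` in the direction `a`. -/
def dirDz {n : ℕ} (a : Fin n → ℂ) (F : (Fin n → ℂ) → ℂ) (z : Fin n → ℂ) : ℂ :=
  (1 / 2) * (fderiv ℝ F z a - I * fderiv ℝ F z (I • a))

/-- The Wirtinger derivative `∑ conj(a_j) ∂F/∂z̄_j` in the direction `a`. -/
def dirDzbar {n : ℕ} (a : Fin n → ℂ) (F : (Fin n → ℂ) → ℂ) (z : Fin n → ℂ) : ℂ :=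
  (1 / 2) * (fderiv ℝ F z a + I * fderiv ℝ F z (I • a))

/-! ### Calculus of Wirtinger derivatives in a complex direction. -/

section Wirtinger

variable {n : ℕ} {a : Fin n → ℂ} {F G : (Fin n → ℂ) → ℂ} {z : Fin n → ℂ} {D : Set (Fin n → ℂ)}

theorem dz_eq_dirDz (j : Fin n) : dz j F z = dirDz (Pi.single j 1) F z := by
  have : (I • Pi.single j 1 : Fin n → ℂ) = Pi.single j I := by
    rw [← Pi.single_smul]; simp
  rw [dz, dirDz, this]

theorem dzbar_eq_dirDzbar (j : Fin n) : dzbar j F z = dirDzbar (Pi.single j 1) F z := by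
  have : (I • Pi.single j 1 : Fin n → ℂ) = Pi.single j I := by
    rw [← Pi.single_smul]; simp
  rw [dzbar, dirDzbar, this]

theorem fderiv_apply_eq_sum (L : (Fin n → ℂ) →L[ℝ] ℂ) (a : Fin n → ℂ) :
    L a = ∑ j, ((a j).re * L (Pi.single j 1) + (a j).im * L (Pi.single j I)) := by
  conv_lhs => rw [← Finset.univ_sum_single a]
  rw [map_sum]
  refine Finset.sum_congr rfl fun j _ => ?_
  have : (Pi.single j (a j) : Fin n → ℂ) =
      (a j).re • (Pi.single j 1 : Fin n → ℂ) + (a j).im • (Pi.single j I : Fin n → ℂ) := by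
    rw [← Pi.single_smul, ← Pi.single_smul, ← Pi.single_add]
    congr 1
    simp [Complex.re_add_im]
  rw [this, map_add, map_smul, map_smul]
  simp

theorem dirDz_eq_sum : dirDz a F z = ∑ j, a j * dz j F z := by
  rw [dirDz, fderiv_apply_eq_sum _ a, fderiv_apply_eq_sum _ (I • a), Finset.mul_sum,
    ← Finset.sum_sub_distrib, Finset.mul_sum]
  refine Finset.sum_congr rfl fun j _ => ?_
  have h := Complex.re_add_im (a j)
  rw [dz]
  simp
  linear_combination (1 / 2 : ℂ) * (fderiv ℝ F z (Pi.single j 1) -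
    I * fderiv ℝ F z (Pi.single j I)) * h + (1 / 2 : ℂ) * (a j).im *
    (fderiv ℝ F z) (Pi.single j I) * I_mul_I

theorem dirDzbar_eq_sum : dirDzbar a F z = ∑ j, star (a j) * dzbar j F z := by
  rw [dirDzbar, fderiv_apply_eq_sum _ a, fderiv_apply_eq_sum _ (I • a), Finset.mul_sum,
    ← Finset.sum_add_distrib, Finset.mul_sum]
  refine Finset.sum_congr rfl fun j _ => ?_
  have : star (a j) = (a j).re - (a j).im * I := by
    apply Complex.ext <;> simp
  rw [dzbar, this]
  simp
  linear_combination (1 / 2 : ℂ) * (a j).im * (fderiv ℝ F z) (Pi.single j I) *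
    (I_mul_I)

theorem dirDz_mul (hF : DifferentiableAt ℝ F z) (hG : DifferentiableAt ℝ G z) :
    dirDz a (fun w => F w * G w) z = dirDz a F z * G z + F z * dirDz a G z := by
  simp only [dirDz, fderiv_fun_mul hF hG]
  simp
  ring

theorem dirDzbar_mul (hF : DifferentiableAt ℝ F z) (hG : DifferentiableAt ℝ G z) :
    dirDzbar a (fun w => F w * G w) z = dirDzbar a F z * G z + F z * dirDzbar a G z := by
  simp only [dirDzbar, fderiv_fun_mul hF hG]
  simp
  ring

theorem dirDzbar_sub (hF : DifferentiableAt ℝ F z) (hG : DifferentiableAt ℝ G z) :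
    dirDzbar a (fun w => F w - G w) z = dirDzbar a F z - dirDzbar a G z := by
  simp only [dirDzbar, fderiv_fun_sub hF hG]
  simp
  ring

theorem dirDzbar_add (hF : DifferentiableAt ℝ F z) (hG : DifferentiableAt ℝ G z) :
    dirDzbar a (fun w => F w + G w) z = dirDzbar a F z + dirDzbar a G z := by
  simp only [dirDzbar, fderiv_fun_add hF hG]
  simp
  ring

theorem dirDz_add (hF : DifferentiableAt ℝ F z) (hG : DifferentiableAt ℝ G z) :
    dirDz a (fun w => F w + G w) z = dirDz a F z + dirDz a G z := by
  simp only [dirDz, fderiv_fun_add hF hG]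
  simp
  ring

theorem dirDz_star (hF : DifferentiableAt ℝ F z) :
    dirDz a (fun w => star (F w)) z = star (dirDzbar a F z) := by
  have h := hF.hasFDerivAt.star
  simp only [dirDz, dirDzbar, h.fderiv]
  simp [sub_eq_add_neg]

theorem dirDzbar_star (hF : DifferentiableAt ℝ F z) :
    dirDzbar a (fun w => star (F w)) z = star (dirDz a F z) := by
  have h := hF.hasFDerivAt.star
  simp only [dirDz, dirDzbar, h.fderiv]
  simp

theorem dirDzbar_eq_zero (hF : DifferentiableAt ℂ F z) : dirDzbar a F z = 0 := by
  have h := hF.hasFDerivAt.restrictScalars ℝ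
  simp only [dirDzbar, h.fderiv]
  simp only [ContinuousLinearMap.coe_restrictScalars', map_smul, smul_eq_mul]
  linear_combination (1 / 2 : ℂ) * (fderiv ℂ F z) a * I_mul_I

theorem dirDz_eq_fderiv (hF : DifferentiableAt ℂ F z) : dirDz a F z = fderiv ℂ F z a := by
  have h := hF.hasFDerivAt.restrictScalars ℝ
  simp only [dirDz, h.fderiv]
  simp only [ContinuousLinearMap.coe_restrictScalars', map_smul, smul_eq_mul]
  linear_combination (-1 / 2 : ℂ) * (fderiv ℂ F z) a * I_mul_I

theorem dirDz_congr (h : F =ᶠ[nhds z] G) : dirDz a F z = dirDz a G z := by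
  simp only [dirDz, h.fderiv_eq]

theorem dirDzbar_congr (h : F =ᶠ[nhds z] G) : dirDzbar a F z = dirDzbar a G z := by
  simp only [dirDzbar, h.fderiv_eq]

theorem contDiffOn_dirDz {k m : WithTop ℕ∞} (hD : IsOpen D) (hF : ContDiffOn ℝ m F D)
    (hk : k + 1 ≤ m) : ContDiffOn ℝ k (dirDz a F) D := by
  have h := hF.fderiv_of_isOpen hD hk
  exact contDiffOn_const.mul ((h.clm_apply contDiffOn_const).sub
    (contDiffOn_const.mul (h.clm_apply contDiffOn_const)))

theorem contDiffOn_dirDzbar {k m : WithTop ℕ∞} (hD : IsOpen D) (hF : ContDiffOn ℝ m F D)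
    (hk : k + 1 ≤ m) : ContDiffOn ℝ k (dirDzbar a F) D := by
  have h := hF.fderiv_of_isOpen hD hk
  exact contDiffOn_const.mul ((h.clm_apply contDiffOn_const).add
    (contDiffOn_const.mul (h.clm_apply contDiffOn_const)))

theorem dirDz_of_notMem_tsupport (h : z ∉ tsupport F) : dirDz a F z = 0 := by
  simp [dirDz, fderiv_of_notMem_tsupport ℝ h]

theorem dirDzbar_of_notMem_tsupport (h : z ∉ tsupport F) : dirDzbar a F z = 0 := by
  simp [dirDzbar, fderiv_of_notMem_tsupport ℝ h]

theorem dirDz_exp {u : (Fin n → ℂ) → ℂ} (hu : DifferentiableAt ℝ u z) :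
    dirDz a (fun w => exp (u w)) z = exp (u z) * dirDz a u z := by
  have h := hu.hasFDerivAt.cexp
  simp only [dirDz, h.fderiv]
  simp
  ring

theorem dirDzbar_exp {u : (Fin n → ℂ) → ℂ} (hu : DifferentiableAt ℝ u z) :
    dirDzbar a (fun w => exp (u w)) z = exp (u z) * dirDzbar a u z := by
  have h := hu.hasFDerivAt.cexp
  simp only [dirDzbar, h.fderiv]
  simp
  ring

theorem dirDz_neg : dirDz a (fun w => -F w) z = -dirDz a F z := by
  simp only [dirDz, fderiv_fun_neg]
  simp
  ring

theorem dirDzbar_neg : dirDzbar a (fun w => -F w) z = -dirDzbar a F z := by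
  simp only [dirDzbar, fderiv_fun_neg]
  simp
  ring

/-- Wirtinger derivatives in one complex direction commute. -/
theorem dirDzbar_dirDz_comm (hF : ContDiffAt ℝ 2 F z) (b : Fin n → ℂ) :
    dirDzbar b (dirDz a F) z = dirDz a (dirDzbar b F) z := by
  have hd : DifferentiableAt ℝ (fderiv ℝ F) z :=
    (hF.fderiv_right (m := 1) (by norm_num)).differentiableAt (by norm_num)
  have hs := hF.isSymmSndFDerivAt (by simp)
  have key (c : Fin n → ℂ) : HasFDerivAt (fun w => fderiv ℝ F w c)
      ((fderiv ℝ (fderiv ℝ F) z).flip c) z := by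
    simpa using hd.hasFDerivAt.clm_apply (hasFDerivAt_const c z)
  have h1 : HasFDerivAt (dirDz a F) _ z :=
    ((key a).sub ((key (I • a)).const_mul I)).const_mul (1 / 2 : ℂ)
  have h2 : HasFDerivAt (dirDzbar b F) _ z :=
    ((key b).add ((key (I • b)).const_mul I)).const_mul (1 / 2 : ℂ)
  rw [dirDzbar, dirDz, h1.fderiv, h2.fderiv]
  simp
  rw [hs.eq a b, hs.eq a (I • b), hs.eq (I • a) b, hs.eq (I • a) (I • b)]
  ring

/-- The iterated derivative `∂_a ∂̄_a` in terms of the mixed second derivatives. -/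
theorem dirDz_dirDzbar_eq_sum (hF : ContDiffAt ℝ 2 F z) :
    dirDz a (dirDzbar a F) z = ∑ j, ∑ k, a j * star (a k) * dz j (dzbar k F) z := by
  have hd : DifferentiableAt ℝ (fderiv ℝ F) z :=
    (hF.fderiv_right (m := 1) (by norm_num)).differentiableAt (by norm_num)
  have hk (k : Fin n) : DifferentiableAt ℝ (dzbar k F) z :=
    ((hd.clm_apply (differentiableAt_const _)).add
      ((hd.clm_apply (differentiableAt_const _)).const_mul I)).const_mul (1 / 2 : ℂ)
  have h1 : dirDzbar a F = fun w => ∑ k, star (a k) * dzbar k F w := by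
    ext w; exact dirDzbar_eq_sum
  rw [dirDz_eq_sum]
  refine Finset.sum_congr rfl fun j _ => ?_
  have h2 : HasFDerivAt (dirDzbar a F) (∑ k, star (a k) • fderiv ℝ (dzbar k F) z) z := by
    rw [h1]
    exact HasFDerivAt.fun_sum fun k _ => (hk k).hasFDerivAt.const_mul (star (a k))
  rw [dz, h2.fderiv]
  simp only [sum_apply, smul_apply, smul_eq_mul, dz,
    Finset.mul_sum, ← Finset.sum_sub_distrib]
  exact Finset.sum_congr rfl fun k _ => by ring

end Wirtinger

/-! ### Integration by parts against compactly supported functions. -/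

section IntegrationByParts

variable {n : ℕ} {D : Set (Fin n → ℂ)}

/-- A function that is continuous on an open set containing its compact support is integrable. -/
theorem integrable_of_continuousOn_of_tsupport_subset {F : (Fin n → ℂ) → ℂ}
    (hF : ContinuousOn F D) (hc : HasCompactSupport F) (hs : tsupport F ⊆ D) : Integrable F := by
  rw [← integrableOn_iff_integrable_of_support_subset (subset_tsupport F)]
  exact (hF.mono hs).integrableOn_compact hc

theorem differentiable_of_tsupport_subset {F : (Fin n → ℂ) → ℂ} (hD : IsOpen D)
    (hF : DifferentiableOn ℝ F D) (hs : tsupport F ⊆ D) : Differentiable ℝ F := by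
  intro z
  by_cases hz : z ∈ tsupport F
  · exact hF.differentiableAt (hD.mem_nhds (hs hz))
  · exact (HasFDerivAt.of_notMem_tsupport ℝ hz).differentiableAt

/-- Regularity of `u` is only needed on the support of `θ`: values of `u` outside `D` are multiplied
by zero, so the integrals may run over the whole space. -/
theorem integral_mul_fderiv_of_tsupport_subset {u θ : (Fin n → ℂ) → ℂ} (hD : IsOpen D)
    (hu : ContDiffOn ℝ 1 u D) (hθ : ContDiffOn ℝ 1 θ D) (hc : HasCompactSupport θ)
    (hs : tsupport θ ⊆ D) (v : Fin n → ℂ) :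
    Integrable (fun z => u z * fderiv ℝ θ z v) ∧ Integrable (fun z => fderiv ℝ u z v * θ z) ∧
      ∫ z, u z * fderiv ℝ θ z v = -∫ z, fderiv ℝ u z v * θ z := by
  have hu' : ContinuousOn (fun z => fderiv ℝ u z v) D :=
    (hu.continuousOn_fderiv_of_isOpen hD le_rfl).clm_apply continuousOn_const
  have hθ' : ContinuousOn (fun z => fderiv ℝ θ z v) D :=
    (hθ.continuousOn_fderiv_of_isOpen hD le_rfl).clm_apply continuousOn_const
  have hts := tsupport_fderiv_apply_subset ℝ (f := θ) v
  have hc' : HasCompactSupport (fun z => fderiv ℝ θ z v) := hc.mono' (subset_closure.trans hts)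
  have i1 : Integrable (fun z => u z * fderiv ℝ θ z v) :=
    integrable_of_continuousOn_of_tsupport_subset (hu.continuousOn.mul hθ') hc'.mul_left
      ((tsupport_mul_subset_right).trans (hts.trans hs))
  have i2 : Integrable (fun z => fderiv ℝ u z v * θ z) :=
    integrable_of_continuousOn_of_tsupport_subset (hu'.mul hθ.continuousOn) hc.mul_left
      ((tsupport_mul_subset_right).trans hs)
  have i3 : Integrable (fun z => u z * θ z) :=
    integrable_of_continuousOn_of_tsupport_subset (hu.continuousOn.mul hθ.continuousOn) hc.mul_left
      ((tsupport_mul_subset_right).trans hs)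
  refine ⟨i1, i2, integral_mul_fderiv_eq_neg_fderiv_mul_of_integrable i2 i1 i3 ?_ ?_⟩
  · exact fun x hx => (hu.differentiableOn (by norm_num)).differentiableAt (hD.mem_nhds (hs hx))
  · exact fun x _ => differentiable_of_tsupport_subset hD (hθ.differentiableOn (by norm_num)) hs x

theorem integral_mul_dirDzbar {u θ : (Fin n → ℂ) → ℂ} (hD : IsOpen D)
    (hu : ContDiffOn ℝ 1 u D) (hθ : ContDiffOn ℝ 1 θ D) (hc : HasCompactSupport θ)
    (hs : tsupport θ ⊆ D) (a : Fin n → ℂ) :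
    ∫ z, u z * dirDzbar a θ z = -∫ z, dirDzbar a u z * θ z := by
  obtain ⟨i1, j1, e1⟩ := integral_mul_fderiv_of_tsupport_subset hD hu hθ hc hs a
  obtain ⟨i2, j2, e2⟩ := integral_mul_fderiv_of_tsupport_subset hD hu hθ hc hs (I • a)
  have h1 : (fun z => u z * dirDzbar a θ z) = fun z => (1 / 2 : ℂ) * (u z * fderiv ℝ θ z a) +
      (1 / 2 * I) * (u z * fderiv ℝ θ z (I • a)) := by
    ext z; rw [dirDzbar]; ring
  have h2 : (fun z => dirDzbar a u z * θ z) = fun z => (1 / 2 : ℂ) * (fderiv ℝ u z a * θ z) +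
      (1 / 2 * I) * (fderiv ℝ u z (I • a) * θ z) := by
    ext z; rw [dirDzbar]; ring
  rw [h1, h2, integral_add (i1.const_mul _) (i2.const_mul _),
    integral_add (j1.const_mul _) (j2.const_mul _)]
  simp only [integral_const_mul, e1, e2]
  ring

theorem integral_mul_dirDz {u θ : (Fin n → ℂ) → ℂ} (hD : IsOpen D)
    (hu : ContDiffOn ℝ 1 u D) (hθ : ContDiffOn ℝ 1 θ D) (hc : HasCompactSupport θ)
    (hs : tsupport θ ⊆ D) (a : Fin n → ℂ) :
    ∫ z, u z * dirDz a θ z = -∫ z, dirDz a u z * θ z := by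
  obtain ⟨i1, j1, e1⟩ := integral_mul_fderiv_of_tsupport_subset hD hu hθ hc hs a
  obtain ⟨i2, j2, e2⟩ := integral_mul_fderiv_of_tsupport_subset hD hu hθ hc hs (I • a)
  have h1 : (fun z => u z * dirDz a θ z) = fun z => (1 / 2 : ℂ) * (u z * fderiv ℝ θ z a) -
      (1 / 2 * I) * (u z * fderiv ℝ θ z (I • a)) := by
    ext z; rw [dirDz]; ring
  have h2 : (fun z => dirDz a u z * θ z) = fun z => (1 / 2 : ℂ) * (fderiv ℝ u z a * θ z) -
      (1 / 2 * I) * (fderiv ℝ u z (I • a) * θ z) := by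
    ext z; rw [dirDz]; ring
  rw [h1, h2, integral_sub (i1.const_mul _) (i2.const_mul _),
    integral_sub (j1.const_mul _) (j2.const_mul _)]
  simp only [integral_const_mul, e1, e2]
  ring

end IntegrationByParts

/-! ### Holomorphic functions of several variables: Cauchy estimate, smoothness, identity theorem.
-/

section Holomorphic

variable {n : ℕ} {D : Set (Fin n → ℂ)} {f : (Fin n → ℂ) → ℂ}

theorem hasDerivAt_comp_line {x a : Fin n → ℂ} {ζ : ℂ} (hf : DifferentiableAt ℂ f (x + ζ • a)) :
    HasDerivAt (fun ξ : ℂ => f (x + ξ • a)) (fderiv ℂ f (x + ζ • a) a) ζ := by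
  have h : HasDerivAt (fun ξ : ℂ => x + ξ • a) a ζ := by
    simpa using ((hasDerivAt_id ζ).smul_const a).const_add x
  exact hf.hasFDerivAt.comp_hasDerivAt ζ h

/-- Cauchy's estimate for the derivative of a holomorphic function of several variables. -/
theorem norm_fderiv_le_of_forall_mem_closedBall {y : Fin n → ℂ} {ρ M : ℝ} (hρ : 0 < ρ)
    (hf : ∀ x ∈ Metric.closedBall y ρ, DifferentiableAt ℂ f x)
    (hM : ∀ x ∈ Metric.closedBall y ρ, ‖f x‖ ≤ M) : ‖fderiv ℂ f y‖ ≤ M / ρ := by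
  have hM0 : 0 ≤ M := (norm_nonneg _).trans (hM y (Metric.mem_closedBall_self hρ.le))
  refine ContinuousLinearMap.opNorm_le_bound _ (by positivity) fun v => ?_
  rcases eq_or_ne v 0 with rfl | hv
  · simp
  have hv' : 0 < ‖v‖ := norm_pos_iff.2 hv
  -- On the complex line through `y` in direction `v`, the disc of radius `ρ/‖v‖` stays in the ball,
  -- so the one-variable Cauchy estimate applies.
  have hmem : ∀ ζ ∈ Metric.closedBall (0 : ℂ) (ρ / ‖v‖), y + ζ • v ∈ Metric.closedBall y ρ := by
    intro ζ hζ
    rw [mem_closedBall_zero_iff, le_div_iff₀ hv'] at hζ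
    simpa [norm_smul] using hζ
  have hd : DifferentiableOn ℂ (fun ζ : ℂ => f (y + ζ • v)) (Metric.closedBall 0 (ρ / ‖v‖)) :=
    fun ζ hζ => (hasDerivAt_comp_line (hf _ (hmem ζ hζ))).differentiableAt.differentiableWithinAt
  have h := Complex.norm_deriv_le_of_forall_mem_sphere_norm_le (c := 0) (C := M)
    (div_pos hρ hv') (hd.diffContOnCl_ball subset_rfl)
    (fun ζ hζ => hM _ (hmem ζ (Metric.sphere_subset_closedBall hζ)))
  have h0 : HasDerivAt (fun ζ : ℂ => f (y + ζ • v)) (fderiv ℂ f (y + (0 : ℂ) • v) v) 0 :=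
    hasDerivAt_comp_line (by simpa using hf y (Metric.mem_closedBall_self hρ.le))
  rw [h0.deriv] at h
  simp only [zero_smul, add_zero] at h
  calc _ ≤ _ := h
    _ = _ := by field_simp

/-- A directional derivative of a holomorphic function is holomorphic. -/
theorem differentiableOn_fderiv_apply (hD : IsOpen D) (hf : DifferentiableOn ℂ f D)
    (a : Fin n → ℂ) : DifferentiableOn ℂ (fun z => fderiv ℂ f z a) D := by
  intro p hp
  refine DifferentiableAt.differentiableWithinAt ?_
  obtain ⟨ε, hε, hεD⟩ := Metric.nhds_basis_closedBall.mem_iff.1 (hD.mem_nhds hp)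
  -- One third of the radius for the base point `x`, one for the Cauchy circle around it, one for
  -- the Cauchy estimate that bounds `fderiv ℂ f` there.
  set ρ := ε / 3 with hρdef
  have hρ : 0 < ρ := by positivity
  have hdiff : ∀ x ∈ Metric.closedBall p ε, DifferentiableAt ℂ f x := fun x hx =>
    hf.differentiableAt (hD.mem_nhds (hεD hx))
  obtain ⟨M, hM⟩ := (isCompact_closedBall p ε).exists_bound_of_continuousOn
    (hf.continuousOn.mono hεD)
  have hbound : ∀ y ∈ Metric.closedBall p (2 * ρ), ‖fderiv ℂ f y‖ ≤ M / ρ := by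
    intro y hy
    have hsub : Metric.closedBall y ρ ⊆ Metric.closedBall p ε := by
      refine Metric.closedBall_subset_closedBall' ?_
      rw [Metric.mem_closedBall] at hy
      linarith
    exact norm_fderiv_le_of_forall_mem_closedBall hρ (fun x hx => hdiff x (hsub hx))
      fun x hx => hM x (hsub hx)
  -- The summand `1` keeps the radius meaningful when `a = 0`.
  set R := ρ / (‖a‖ + 1) with hRdef
  have hR : 0 < R := by positivity
  have hmem : ∀ x ∈ Metric.ball p ρ, ∀ ζ ∈ Metric.closedBall (0 : ℂ) R,
      x + ζ • a ∈ Metric.closedBall p (2 * ρ) := by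
    intro x hx ζ hζ
    rw [mem_closedBall_zero_iff] at hζ
    rw [Metric.mem_closedBall, dist_eq_norm]
    rw [Metric.mem_ball, dist_eq_norm] at hx
    have h1 : ‖ζ • a‖ ≤ ρ := by
      rw [norm_smul]
      calc ‖ζ‖ * ‖a‖ ≤ R * (‖a‖ + 1) := by gcongr; linarith
        _ = ρ := by rw [hRdef]; field_simp
    calc ‖x + ζ • a - p‖ = ‖(x - p) + ζ • a‖ := by congr 1; abel
      _ ≤ ‖x - p‖ + ‖ζ • a‖ := norm_add_le _ _
      _ ≤ 2 * ρ := by linarith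
  have h2ρ : Metric.closedBall p (2 * ρ) ⊆ Metric.closedBall p ε :=
    Metric.closedBall_subset_closedBall (by linarith)
  have hcm : ∀ θ : ℝ, circleMap 0 R θ ∈ Metric.closedBall (0 : ℂ) R := fun θ =>
    circleMap_mem_closedBall _ hR.le θ
  set k : ℝ → ℂ := fun θ => deriv (circleMap 0 R) θ * ((circleMap 0 R θ) ^ 2)⁻¹ with hk
  have hkc : Continuous k := by
    refine Continuous.mul ?_ (Continuous.inv₀ (by fun_prop) fun θ => ?_)
    · simp only [funext (fun θ => deriv_circleMap 0 R θ)]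
      fun_prop
    · exact pow_ne_zero 2 (circleMap_ne_center hR.ne')
  have hformula : ∀ x ∈ Metric.ball p ρ, fderiv ℂ f x a =
      (2 * Real.pi * I : ℂ)⁻¹ * ∫ θ in (0 : ℝ)..2 * Real.pi, k θ * f (x + circleMap 0 R θ • a) := by
    intro x hx
    have hd : DifferentiableOn ℂ (fun ζ : ℂ => f (x + ζ • a)) (Metric.closedBall 0 R) :=
      fun ζ hζ => (hasDerivAt_comp_line
        (hdiff _ (h2ρ (hmem x hx ζ hζ)))).differentiableAt.differentiableWithinAt
    have h0 : HasDerivAt (fun ζ : ℂ => f (x + ζ • a)) (fderiv ℂ f (x + (0 : ℂ) • a) a) 0 :=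
      hasDerivAt_comp_line (hdiff _ (h2ρ (hmem x hx 0 (by simp [hR.le]))))
    have h := (hd.diffContOnCl_ball subset_rfl).deriv_eq_smul_circleIntegral hR
    rw [h0.deriv] at h
    simp only [zero_smul, add_zero] at h
    rw [eq_inv_mul_iff_mul_eq₀ two_pi_I_ne_zero, ← smul_eq_mul (a := (2 * Real.pi * I : ℂ)), ← h,
      circleIntegral]
    refine intervalIntegral.integral_congr fun θ _ => ?_
    simp only [hk, smul_eq_mul, sub_zero]
    ring
  -- Cauchy's formula expresses the directional derivative through values of `f` alone, so
  -- differentiating under the integral sign needs only the bound on the first derivative.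
  have hder : HasFDerivAt
      (fun x => ∫ θ in (0 : ℝ)..2 * Real.pi, k θ * f (x + circleMap 0 R θ • a))
      (∫ θ in (0 : ℝ)..2 * Real.pi, k θ • fderiv ℂ f (p + circleMap 0 R θ • a)) p := by
    obtain ⟨K, hK⟩ := (isCompact_uIcc (a := (0 : ℝ)) (b := 2 * Real.pi)).exists_bound_of_continuousOn
      hkc.continuousOn
    have hcont : ∀ x ∈ Metric.ball p ρ,
        Continuous fun θ : ℝ => k θ * f (x + circleMap 0 R θ • a) := by
      intro x hx
      refine hkc.mul (hf.continuousOn.comp_continuous (by fun_prop) fun θ => ?_)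
      exact hεD (h2ρ (hmem x hx _ (hcm θ)))
    refine intervalIntegral.hasFDerivAt_integral_of_dominated_of_fderiv_le
      (F' := fun x θ => k θ • fderiv ℂ f (x + circleMap 0 R θ • a))
      (s := Metric.ball p ρ) (bound := fun _ => K * (M / ρ)) (Metric.ball_mem_nhds p hρ) ?_ ?_ ?_ ?_
      ?_ ?_
    · filter_upwards [Metric.ball_mem_nhds p hρ] with x hx
      exact (hcont x hx).aestronglyMeasurable
    · exact (hcont p (Metric.mem_ball_self hρ)).intervalIntegrable _ _
    · refine (hkc.aestronglyMeasurable.smul ?_)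
      refine Measurable.aestronglyMeasurable ?_
      exact (measurable_fderiv ℂ f).comp (Continuous.measurable (by fun_prop))
    · refine Filter.Eventually.of_forall fun θ hθ x hx => ?_
      rw [norm_smul]
      have h1 := hK θ (Set.uIoc_subset_uIcc hθ)
      exact mul_le_mul h1 (hbound _ (hmem x hx _ (hcm θ))) (norm_nonneg _)
        ((norm_nonneg _).trans h1)
    · exact intervalIntegrable_const
    · refine Filter.Eventually.of_forall fun θ _ x hx => ?_
      have h1 : HasFDerivAt (fun y : Fin n → ℂ => y + circleMap 0 R θ • a)
          (ContinuousLinearMap.id ℂ _) x := (hasFDerivAt_id x).add_const _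
      have h2 := (hdiff _ (h2ρ (hmem x hx _ (hcm θ)))).hasFDerivAt.comp x h1
      exact h2.const_mul (k θ)
  refine (hder.differentiableAt.const_mul ((2 * Real.pi * I : ℂ)⁻¹)).congr_of_eventuallyEq ?_
  filter_upwards [Metric.ball_mem_nhds p hρ] with x hx using hformula x hx

/-- Holomorphic functions of several variables are smooth. -/
theorem contDiffOn_of_differentiableOn (hD : IsOpen D) (m : ℕ) :
    ∀ {f : (Fin n → ℂ) → ℂ}, DifferentiableOn ℂ f D → ContDiffOn ℂ m f D := by
  induction m with
  | zero => exact fun hf => contDiffOn_zero.2 hf.continuousOn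
  | succ m ih =>
    intro f hf
    push_cast
    rw [contDiffOn_succ_iff_fderiv_of_isOpen hD]
    refine ⟨hf, fun h => absurd h (by exact_mod_cast WithTop.coe_ne_top), ?_⟩
    exact contDiffOn_clm_apply.2 fun a => ih (differentiableOn_fderiv_apply hD hf a)

theorem contDiffOn_real_of_differentiableOn (hD : IsOpen D) (hf : DifferentiableOn ℂ f D) (m : ℕ) :
    ContDiffOn ℝ m f D :=
  (contDiffOn_of_differentiableOn hD m hf).restrict_scalars ℝ

/-- The identity theorem for holomorphic functions of several variables. -/
theorem eqOn_zero_of_eventuallyEq_zero (hD : IsOpen D) (hDc : IsPreconnected D)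
    (hf : DifferentiableOn ℂ f D) {p : Fin n → ℂ} (hp : p ∈ D) (h0 : f =ᶠ[nhds p] 0) :
    Set.EqOn f 0 D := by
  have hopen : IsOpen {z | f =ᶠ[nhds z] 0} := isOpen_setOfPred_eventually_nhds
  suffices hsub : D ⊆ {z | f =ᶠ[nhds z] 0} from fun z hz => (hsub hz).eq_of_nhds
  -- Connectedness: the open set where `f` vanishes locally is shown to be relatively closed in `D`.
  refine hDc.subset_of_closure_inter_subset hopen ⟨p, hp, h0⟩ ?_
  rintro z ⟨hzc, hzD⟩
  obtain ⟨ρ, hρ, hρD⟩ := Metric.isOpen_iff.1 hD z hzD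
  obtain ⟨w, hw, hwz⟩ := Metric.mem_closure_iff.1 hzc ρ hρ
  have hwb : w ∈ Metric.ball z ρ := by rwa [Metric.mem_ball, dist_comm]
  refine Filter.eventually_of_mem (Metric.ball_mem_nhds z hρ) fun q hq => ?_
  -- The complex line joining `w` to `q` meets the ball in a convex set, and the one-variable
  -- identity theorem carries the vanishing from `w` to `q`.
  let L : ℂ → (Fin n → ℂ) := fun ζ => w + ζ • (q - w)
  have hLc : Continuous L := by fun_prop
  have hU : IsOpen (L ⁻¹' Metric.ball z ρ) := Metric.isOpen_ball.preimage hLc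
  have hUc : Convex ℝ (L ⁻¹' Metric.ball z ρ) := by
    intro ζ hζ ξ hξ s t hs ht hst
    have : L (s • ζ + t • ξ) = s • L ζ + t • L ξ := by
      simp only [L]
      ext j
      have : (s : ℂ) + t = 1 := by exact_mod_cast hst
      simp
      linear_combination (-w j) * this
    rw [Set.mem_preimage, this]
    exact convex_ball z ρ hζ hξ hs ht hst
  have hd : DifferentiableOn ℂ (fun ζ => f (L ζ)) (L ⁻¹' Metric.ball z ρ) := fun ζ hζ =>
    (hasDerivAt_comp_line (hf.differentiableAt
      (hD.mem_nhds (hρD hζ)))).differentiableAt.differentiableWithinAt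
  have hL0 : L 0 = w := by simp [L]
  have hL1 : L 1 = q := by simp [L]
  have h00 : (fun ζ => f (L ζ)) =ᶠ[nhds 0] 0 := by
    have : Filter.Tendsto L (nhds 0) (nhds w) := by
      simpa [hL0] using hLc.tendsto 0
    exact this.eventually hw
  have := (hd.analyticOnNhd hU).eqOn_zero_of_preconnected_of_eventuallyEq_zero
    hUc.isPreconnected (by simpa [hL0] using hwb) h00 (show (1 : ℂ) ∈ _ by simpa [hL1] using hq)
  simpa [hL1] using this

end Holomorphic

/-! ### Weighted adjoint of `∂̄` and the Bochner–Kodaira identity. -/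

/-- The `(1,0)`-derivative `e^u ∂_a(α e^{-u})` twisted by the weight `u`. -/
def twistedDz {n : ℕ} (u : (Fin n → ℂ) → ℝ) (a : Fin n → ℂ) (α : (Fin n → ℂ) → ℂ)
    (z : Fin n → ℂ) : ℂ :=
  dirDz a α z - α z * dirDz a (fun w => (u w : ℂ)) z

/-- The Levi form `∑ a_j conj(a_k) ∂²u/∂z_j∂z̄_k`. -/
def leviForm {n : ℕ} (u : (Fin n → ℂ) → ℝ) (a : Fin n → ℂ) (z : Fin n → ℂ) : ℝ :=
  (dirDz a (dirDzbar a (fun w => (u w : ℂ))) z).re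

section Twisted

variable {n : ℕ} {D : Set (Fin n → ℂ)} {u : (Fin n → ℂ) → ℝ} {α : (Fin n → ℂ) → ℂ}

theorem contDiffOn_ofReal {m : WithTop ℕ∞} (hu : ContDiffOn ℝ m u D) :
    ContDiffOn ℝ m (fun z => (u z : ℂ)) D :=
  ofRealCLM.contDiff.comp_contDiffOn hu

theorem contDiffOn_weight {m : WithTop ℕ∞} (hu : ContDiffOn ℝ m u D) :
    ContDiffOn ℝ m (fun z => exp (-(u z : ℂ))) D :=
  (contDiffOn_ofReal hu).neg.cexp

theorem contDiffOn_star {m : WithTop ℕ∞} (hα : ContDiffOn ℝ m α D) :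
    ContDiffOn ℝ m (fun z => star (α z)) D :=
  conjCLE.contDiff.comp_contDiffOn hα

theorem tsupport_dirDz_subset (a : Fin n → ℂ) : tsupport (dirDz a α) ⊆ tsupport α :=
  closure_minimal (fun z hz => by
    by_contra h; exact hz (dirDz_of_notMem_tsupport h)) (isClosed_tsupport α)

theorem tsupport_dirDzbar_subset (a : Fin n → ℂ) : tsupport (dirDzbar a α) ⊆ tsupport α :=
  closure_minimal (fun z hz => by
    by_contra h; exact hz (dirDzbar_of_notMem_tsupport h)) (isClosed_tsupport α)

theorem tsupport_twistedDz_subset (a : Fin n → ℂ) : tsupport (twistedDz u a α) ⊆ tsupport α :=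
  closure_minimal (fun z hz => by
    by_contra h
    exact hz (by simp [twistedDz, dirDz_of_notMem_tsupport h, image_eq_zero_of_notMem_tsupport h]))
    (isClosed_tsupport α)

theorem contDiffOn_twistedDz (hD : IsOpen D) (hu : ContDiffOn ℝ 2 u D) (hα : ContDiffOn ℝ 2 α D)
    (a : Fin n → ℂ) : ContDiffOn ℝ 1 (twistedDz u a α) D :=
  (contDiffOn_dirDz hD hα (by norm_num)).sub ((hα.of_le (by norm_num)).mul
    (contDiffOn_dirDz hD (contDiffOn_ofReal hu) (by norm_num)))

theorem tsupport_star_mul_subset (v : (Fin n → ℂ) → ℂ) :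
    tsupport (fun z => star (α z) * v z) ⊆ tsupport α := by
  refine closure_mono fun z hz => ?_
  contrapose! hz
  simp [Function.notMem_support.1 hz]

theorem star_dirDz_ofReal (hD : IsOpen D) (hu : ContDiffOn ℝ 1 u D) {z : Fin n → ℂ} (hz : z ∈ D)
    (a : Fin n → ℂ) :
    star (dirDz a (fun w => (u w : ℂ)) z) = dirDzbar a (fun w => (u w : ℂ)) z := by
  have h := ((contDiffOn_ofReal hu).differentiableOn (by norm_num)).differentiableAt
    (hD.mem_nhds hz)
  rw [← dirDzbar_star h]
  simp

theorem dirDzbar_star_mul_weight (hD : IsOpen D) (hu : ContDiffOn ℝ 1 u D)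
    (hα : ContDiffOn ℝ 1 α D) (hs : tsupport α ⊆ D) (a z : Fin n → ℂ) :
    dirDzbar a (fun w => star (α w) * exp (-(u w : ℂ))) z =
      star (twistedDz u a α z) * exp (-(u z : ℂ)) := by
  -- Nothing is known about `u` off `D`; both sides vanish there because `α` does.
  by_cases hz : z ∈ D
  · have h1 := (hα.differentiableOn (by norm_num)).differentiableAt (hD.mem_nhds hz)
    have h2 := ((contDiffOn_ofReal hu).differentiableOn (by norm_num)).differentiableAt
      (hD.mem_nhds hz)
    have h3 : DifferentiableAt ℝ (fun w => -(u w : ℂ)) z := h2.neg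
    rw [dirDzbar_mul h1.star h3.cexp, dirDzbar_star h1, dirDzbar_exp h3, dirDzbar_neg,
      twistedDz, star_sub, star_mul', star_dirDz_ofReal hD hu hz]
    ring
  · have h1 : z ∉ tsupport α := fun h => hz (hs h)
    rw [dirDzbar_of_notMem_tsupport fun h => h1 (tsupport_star_mul_subset _ h),
      image_eq_zero_of_notMem_tsupport fun h => h1 (tsupport_twistedDz_subset a h)]
    simp

/-- The twisted derivative is the adjoint of `-∂̄_a` in the weighted `L²` space. -/
theorem integral_mul_star_twistedDz (hD : IsOpen D) (hu : ContDiffOn ℝ 1 u D)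
    (hα : ContDiffOn ℝ 1 α D) (hc : HasCompactSupport α) (hs : tsupport α ⊆ D)
    {v : (Fin n → ℂ) → ℂ} (hv : ContDiffOn ℝ 1 v D) (a : Fin n → ℂ) :
    ∫ z, v z * (star (twistedDz u a α z) * exp (-(u z : ℂ))) =
      -∫ z, dirDzbar a v z * (star (α z) * exp (-(u z : ℂ))) := by
  simp_rw [← dirDzbar_star_mul_weight hD hu hα hs a]
  refine integral_mul_dirDzbar hD hv ?_ ?_ ((tsupport_star_mul_subset _).trans hs) a
  · exact (contDiffOn_star hα).mul (contDiffOn_weight hu)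
  · exact hc.mono' (subset_closure.trans (tsupport_star_mul_subset _))

/-- The adjoint relation moves one twisted derivative to a `∂̄_a`, which is commuted past the other
at the cost of `-α ∂_a∂̄_a u`. Integrating by parts once more turns the remaining term into the norm
of `∂̄_a α`. -/
theorem integral_norm_twistedDz_sq_complex (hD : IsOpen D) (hu : ContDiffOn ℝ 2 u D)
    (hα : ContDiffOn ℝ 2 α D) (hc : HasCompactSupport α) (hs : tsupport α ⊆ D) (a : Fin n → ℂ) :
    ∫ z, twistedDz u a α z * (star (twistedDz u a α z) * exp (-(u z : ℂ))) =
      (∫ z, dirDz a (dirDzbar a (fun w => (u w : ℂ))) z * (α z * (star (α z) * exp (-(u z : ℂ)))))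
      + ∫ z, dirDzbar a α z * (star (dirDzbar a α z) * exp (-(u z : ℂ))) := by
  have hu1 : ContDiffOn ℝ 1 u D := hu.of_le (by norm_num)
  have hα1 : ContDiffOn ℝ 1 α D := hα.of_le (by norm_num)
  have hU := contDiffOn_ofReal hu
  have hE := contDiffOn_weight hu1
  have hη := contDiffOn_dirDzbar (a := a) (k := 1) hD hα (by norm_num)
  have hηs := tsupport_dirDzbar_subset (α := α) a
  have hL : ContinuousOn (dirDz a (dirDzbar a (fun w => (u w : ℂ)))) D :=
    (contDiffOn_dirDz (k := 0) hD (contDiffOn_dirDzbar (k := 1) hD hU (by norm_num))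
      (by norm_num)).continuousOn
  have hαE : tsupport (fun z => star (α z) * exp (-(u z : ℂ))) ⊆ tsupport α :=
    tsupport_star_mul_subset _
  have hαEc : HasCompactSupport (fun z => star (α z) * exp (-(u z : ℂ))) :=
    hc.mono' (subset_closure.trans hαE)
  rw [integral_mul_star_twistedDz hD hu1 hα1 hc hs (contDiffOn_twistedDz hD hu hα a)]
  have hηE : ContDiffOn ℝ 1 (fun w => dirDzbar a α w * exp (-(u w : ℂ))) D := hη.mul hE
  have hηEs : tsupport (fun w => dirDzbar a α w * exp (-(u w : ℂ))) ⊆ tsupport α :=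
    (tsupport_mul_subset_left).trans hηs
  have hηEc : HasCompactSupport (fun w => dirDzbar a α w * exp (-(u w : ℂ))) :=
    hc.mono' (subset_closure.trans hηEs)
  have hpt : ∀ z, dirDzbar a (twistedDz u a α) z * (star (α z) * exp (-(u z : ℂ))) =
      star (α z) * dirDz a (fun w => dirDzbar a α w * exp (-(u w : ℂ))) z -
        dirDz a (dirDzbar a (fun w => (u w : ℂ))) z * (α z * (star (α z) * exp (-(u z : ℂ)))) := by
    intro z
    by_cases hz : z ∈ D
    · have hn := hD.mem_nhds hz
      have d1 := (hα1.differentiableOn (by norm_num)).differentiableAt hn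
      have d2 := (hU.differentiableOn (by norm_num)).differentiableAt hn
      have d3 := (hη.differentiableOn (by norm_num)).differentiableAt hn
      have d4 := ((contDiffOn_dirDz (a := a) (k := 1) hD hα (by norm_num)).differentiableOn
        (by norm_num)).differentiableAt hn
      have d5 := ((contDiffOn_dirDz (a := a) (k := 1) hD hU (by norm_num)).differentiableOn
        (by norm_num)).differentiableAt hn
      have e1 : dirDzbar a (twistedDz u a α) z = dirDzbar a (dirDz a α) z -
          (dirDzbar a α z * dirDz a (fun w => (u w : ℂ)) z +
            α z * dirDzbar a (dirDz a (fun w => (u w : ℂ))) z) := by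
        rw [← dirDzbar_mul d1 d5]
        exact dirDzbar_sub d4 (d1.mul d5)
      have d6 : DifferentiableAt ℝ (fun w => -(u w : ℂ)) z := d2.neg
      rw [e1, dirDzbar_dirDz_comm (hα.contDiffAt hn), dirDzbar_dirDz_comm (hU.contDiffAt hn),
        dirDz_mul d3 d6.cexp, dirDz_exp d6, dirDz_neg]
      ring
    · have h1 : z ∉ tsupport α := fun h => hz (hs h)
      simp [image_eq_zero_of_notMem_tsupport h1]
  simp_rw [hpt]
  rw [integral_sub, integral_mul_dirDz hD (contDiffOn_star hα1) hηE hηEc (hηEs.trans hs)]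
  · have : ∀ z, dirDz a (fun w => star (α w)) z * (dirDzbar a α z * exp (-(u z : ℂ))) =
        dirDzbar a α z * (star (dirDzbar a α z) * exp (-(u z : ℂ))) := by
      intro z
      by_cases hz : z ∈ D
      · rw [dirDz_star ((hα1.differentiableOn (by norm_num)).differentiableAt (hD.mem_nhds hz))]
        ring
      · have h1 : z ∉ tsupport α := fun h => hz (hs h)
        simp [dirDzbar_of_notMem_tsupport h1]
    simp only [this]
    ring
  · refine integrable_of_continuousOn_of_tsupport_subset (D := D) ?_ ?_ ?_
    · exact (contDiffOn_star hα1).continuousOn.mul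
        (contDiffOn_dirDz (k := 0) hD hηE (by norm_num)).continuousOn
    · exact (hηEc.mono' (subset_closure.trans (tsupport_dirDz_subset a))).mul_left
    · exact (tsupport_mul_subset_right).trans
        ((tsupport_dirDz_subset a).trans (hηEs.trans hs))
  · refine integrable_of_continuousOn_of_tsupport_subset (D := D) ?_ ?_ ?_
    · exact hL.mul (hα1.continuousOn.mul ((contDiffOn_star hα1).continuousOn.mul hE.continuousOn))
    · exact (hαEc.mul_left).mul_left
    · exact (tsupport_mul_subset_right).trans ((tsupport_mul_subset_right).trans (hαE.trans hs))

theorem mul_star_mul_weight (c : ℂ) (x : ℝ) :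
    c * (star c * exp (-(x : ℂ))) = ((‖c‖ ^ 2 * Real.exp (-x) : ℝ) : ℂ) := by
  rw [← mul_assoc]
  have : c * star c = ((‖c‖ ^ 2 : ℝ) : ℂ) := by
    rw [Complex.star_def, Complex.mul_conj, Complex.normSq_eq_norm_sq]
  rw [this]; push_cast; ring

/-- The weighted Bochner–Kodaira identity in one complex direction. -/
theorem integral_norm_twistedDz_sq (hD : IsOpen D) (hu : ContDiffOn ℝ 2 u D)
    (hα : ContDiffOn ℝ 2 α D) (hc : HasCompactSupport α) (hs : tsupport α ⊆ D) (a : Fin n → ℂ) :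
    ∫ z, ‖twistedDz u a α z‖ ^ 2 * Real.exp (-u z) =
      (∫ z, leviForm u a z * (‖α z‖ ^ 2 * Real.exp (-u z))) +
        ∫ z, ‖dirDzbar a α z‖ ^ 2 * Real.exp (-u z) := by
  have h := congrArg re (integral_norm_twistedDz_sq_complex hD hu hα hc hs a)
  have hL : ContinuousOn (dirDz a (dirDzbar a (fun w => (u w : ℂ)))) D :=
    (contDiffOn_dirDz (k := 0) hD (contDiffOn_dirDzbar (k := 1) hD (contDiffOn_ofReal hu)
      (by norm_num)) (by norm_num)).continuousOn
  have hint : Integrable fun z => dirDz a (dirDzbar a (fun w => (u w : ℂ))) z *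
      (α z * (star (α z) * exp (-(u z : ℂ)))) := by
    refine integrable_of_continuousOn_of_tsupport_subset (D := D) ?_ ?_ ?_
    · exact hL.mul (hα.continuousOn.mul
        ((contDiffOn_star hα).continuousOn.mul (contDiffOn_weight hu).continuousOn))
    · exact (hc.mul_right).mul_left
    · exact (tsupport_mul_subset_right).trans ((tsupport_mul_subset_left).trans hs)
  rw [add_re] at h
  have h2 : (∫ z, dirDz a (dirDzbar a (fun w => (u w : ℂ))) z *
      (α z * (star (α z) * exp (-(u z : ℂ))))).re =
      ∫ z, leviForm u a z * (‖α z‖ ^ 2 * Real.exp (-u z)) := by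
    have := reCLM.integral_comp_comm hint
    simp only [reCLM_apply] at this
    rw [← this]
    refine integral_congr_ae (Filter.Eventually.of_forall fun z => ?_)
    simp only [mul_star_mul_weight, re_mul_ofReal, leviForm]
  rw [h2] at h
  simp only [mul_star_mul_weight, integral_complex_ofReal, ofReal_re] at h
  exact h

end Twisted

/-! ### Pythagoras and Cauchy–Schwarz in coordinates. -/

section Algebra

theorem ofReal_norm_sq (x : ℂ) : ((‖x‖ ^ 2 : ℝ) : ℂ) = x * star x := by
  rw [Complex.star_def, Complex.mul_conj, Complex.normSq_eq_norm_sq]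

theorem sqNorm_nonneg {k : ℕ} (v : Fin k → ℂ) : 0 ≤ sqNorm v :=
  Finset.sum_nonneg fun _ _ => by positivity

theorem ofReal_sqNorm {k : ℕ} (v : Fin k → ℂ) : ((sqNorm v : ℝ) : ℂ) = ∑ i, v i * star (v i) := by
  simp only [sqNorm, ofReal_sum, ofReal_norm_sq]

/-- Pythagoras for the orthogonal projection of `y` onto the line through the conjugate of `g`. -/
theorem sqNorm_sub_projection {k : ℕ} (g y : Fin k → ℂ) (hg : sqNorm g ≠ 0) :
    sqNorm (fun i => y i - star (g i) * ((∑ l, g l * y l) / (sqNorm g : ℂ))) =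
      sqNorm y - ‖∑ l, g l * y l‖ ^ 2 / sqNorm g := by
  set T := ∑ l, g l * y l with hT
  have hgQ := ofReal_sqNorm g
  set Q : ℝ := sqNorm g
  have hg' : (Q : ℂ) ≠ 0 := by exact_mod_cast hg
  have hQs : star (Q : ℂ) = Q := conj_ofReal _
  apply Complex.ofReal_injective
  have hexp : ∀ i, (y i - star (g i) * (T / (Q : ℂ))) * star (y i - star (g i) * (T / (Q : ℂ))) =
      y i * star (y i) - g i * y i * (star T / (Q : ℂ)) - star (g i * y i) * (T / (Q : ℂ)) +
        g i * star (g i) * (T * star T / (Q : ℂ) ^ 2) := by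
    intro i
    simp only [star_sub, star_mul', star_star, star_div₀, hQs]
    field_simp
    ring
  rw [ofReal_sqNorm, ofReal_sub, ofReal_div, ofReal_norm_sq, ofReal_sqNorm y]
  simp only [hexp, Finset.sum_add_distrib, Finset.sum_sub_distrib, ← Finset.sum_mul]
  rw [← star_sum, ← hT, ← hgQ]
  field_simp
  ring

theorem sqNorm_eq_one {n r : ℕ} {a : Fin r → Fin n → ℂ}
    (ha : ∀ l m, ∑ j, star (a l j) * a m j = if l = m then 1 else 0) (l : Fin r) :
    sqNorm (a l) = 1 := by
  apply Complex.ofReal_injective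
  rw [ofReal_sqNorm]
  simpa [mul_comm] using ha l l

theorem norm_sum_mul_sq_le {ι : Type*} [Fintype ι] (x y : ι → ℂ) :
    ‖∑ i, x i * y i‖ ^ 2 ≤ (∑ i, ‖x i‖ ^ 2) * ∑ i, ‖y i‖ ^ 2 := by
  calc ‖∑ i, x i * y i‖ ^ 2 ≤ (∑ i, ‖x i‖ * ‖y i‖) ^ 2 := by
        gcongr
        exact (norm_sum_le _ _).trans_eq (Finset.sum_congr rfl fun i _ => norm_mul _ _)
    _ ≤ _ := Finset.sum_mul_sq_le_sq_mul_sq _ _ _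

end Algebra

section Calculus

variable {n : ℕ} {a : Fin n → ℂ} {z : Fin n → ℂ}

theorem dirDz_sum {ι : Type*} (s : Finset ι) {F : ι → (Fin n → ℂ) → ℂ}
    (hF : ∀ i ∈ s, DifferentiableAt ℝ (F i) z) :
    dirDz a (fun w => ∑ i ∈ s, F i w) z = ∑ i ∈ s, dirDz a (F i) z := by
  simp only [dirDz, fderiv_fun_sum hF, sum_apply, Finset.mul_sum, ← Finset.sum_sub_distrib]

theorem dirDzbar_sum {ι : Type*} (s : Finset ι) {F : ι → (Fin n → ℂ) → ℂ}
    (hF : ∀ i ∈ s, DifferentiableAt ℝ (F i) z) :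
    dirDzbar a (fun w => ∑ i ∈ s, F i w) z = ∑ i ∈ s, dirDzbar a (F i) z := by
  simp only [dirDzbar, fderiv_fun_sum hF, sum_apply, Finset.mul_sum, ← Finset.sum_add_distrib]

theorem dirDz_const_mul {F : (Fin n → ℂ) → ℂ} (c : ℂ) (hF : DifferentiableAt ℝ F z) :
    dirDz a (fun w => c * F w) z = c * dirDz a F z := by
  rw [dirDz_mul (differentiableAt_const c) hF]
  simp [dirDz]

theorem dirDzbar_const_mul {F : (Fin n → ℂ) → ℂ} (c : ℂ) (hF : DifferentiableAt ℝ F z) :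
    dirDzbar a (fun w => c * F w) z = c * dirDzbar a F z := by
  rw [dirDzbar_mul (differentiableAt_const c) hF]
  simp [dirDzbar]

theorem dirDz_sub_const {F : (Fin n → ℂ) → ℂ} (c : ℂ) :
    dirDz a (fun w => F w - c) z = dirDz a F z := by
  simp [dirDz, fderiv_sub_const]

theorem dirDz_coord (i : Fin n) : dirDz a (fun w => w i) z = a i := by
  have h : HasFDerivAt (fun w : Fin n → ℂ => w i)
      (ContinuousLinearMap.proj (R := ℂ) (φ := fun _ : Fin n => ℂ) i) z := hasFDerivAt_apply i z
  rw [dirDz_eq_fderiv h.differentiableAt, h.fderiv]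
  rfl

end Calculus

/-! ### The second fundamental form and its size. -/

section SecondFundamentalForm

variable {n k : ℕ} {g : Fin k → (Fin n → ℂ) → ℂ} {z : Fin n → ℂ}

theorem differentiableAt_sqNorm (hg : ∀ i, DifferentiableAt ℝ (g i) z) :
    DifferentiableAt ℝ (fun w => ((sqNorm fun i => g i w : ℝ) : ℂ)) z := by
  simp only [ofReal_sqNorm]
  exact DifferentiableAt.fun_sum fun i _ => (hg i).mul (hg i).star

/-- The functions differentiated in `beta` and `betaStar` are conjugate to each other; the factor
`|g|²` is the one in the definition of `beta`. This makes `β^* ∧ β` a rank-one term in `betaStar`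
alone. -/
theorem beta_eq (hg : ∀ i, DifferentiableAt ℝ (g i) z) (h0 : sqNorm (fun i => g i z) ≠ 0)
    (j : Fin n) (l : Fin k) :
    beta g z j l = (sqNorm fun i => g i z : ℝ) * star (betaStar g z j l) := by
  have h0' : ((sqNorm fun i => g i z : ℝ) : ℂ) ≠ 0 := by exact_mod_cast h0
  have hd : DifferentiableAt ℝ (fun w => g l w / ((sqNorm fun i => g i w : ℝ) : ℂ)) z := by
    simp only [div_eq_mul_inv]
    exact (hg l).mul ((differentiableAt_sqNorm hg).inv h0')
  have : (fun w => star (g l w) / ((sqNorm fun i => g i w : ℝ) : ℂ)) =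
      fun w => star (g l w / ((sqNorm fun i => g i w : ℝ) : ℂ)) := by
    ext w; simp
  rw [beta, betaStar, this, dzbar_eq_dirDzbar, dirDzbar_star hd, dz_eq_dirDz]
  simp

/-- The size of the second fundamental form is controlled by the derivatives of `g`. -/
theorem sum_norm_betaStar_sq_le (hg : ∀ i, DifferentiableAt ℂ (g i) z)
    (h0 : sqNorm (fun i => g i z) ≠ 0) :
    ∑ x : Fin n × Fin k, ‖betaStar g z x.1 x.2‖ ^ 2 ≤
      (∑ j, ∑ l, ‖dz j (g l) z‖ ^ 2) / (sqNorm fun i => g i z) ^ 2 := by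
  set q : ℝ := sqNorm fun i => g i z with hq
  have hq0 : 0 < q := lt_of_le_of_ne (sqNorm_nonneg _) (Ne.symm h0)
  have h0' : (q : ℂ) ≠ 0 := by exact_mod_cast h0
  have hgr : ∀ i, DifferentiableAt ℝ (g i) z := fun i => (hg i).restrictScalars ℝ
  rw [Fintype.sum_prod_type, Finset.sum_div]
  refine Finset.sum_le_sum fun j _ => ?_
  set G : Fin k → ℂ := fun i => g i z with hG
  set y : Fin k → ℂ := fun i => star (dz j (g i) z) with hy
  have hdq : dzbar j (fun w => ((sqNorm fun i => g i w : ℝ) : ℂ)) z = ∑ i, G i * y i := by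
    simp only [ofReal_sqNorm, dzbar_eq_dirDzbar]
    rw [dirDzbar_sum (F := fun i w => g i w * star (g i w)) _
      fun i _ => (hgr i).mul (hgr i).star]
    refine Finset.sum_congr rfl fun i _ => ?_
    rw [dirDzbar_mul (hgr i) (hgr i).star, dirDzbar_eq_zero (hg i), dirDzbar_star (hgr i)]
    simp [hG, hy, dz_eq_dirDz]
  -- Up to the factor `-1/q`, `β^*_j` is the component of `conj(∂_j g)` orthogonal to `conj(g)`, so
  -- its norm is at most that of `∂_j g` divided by `q`.
  have hb : ∀ l, betaStar g z j l =
      -(y l - star (G l) * ((∑ i, G i * y i) / (q : ℂ))) / (q : ℂ) := by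
    intro l
    have hQ := differentiableAt_sqNorm hgr
    have hinv : DifferentiableAt ℝ
        (fun w => (((sqNorm fun i => g i w : ℝ) : ℂ))⁻¹) z := hQ.inv h0'
    have hinvd : dzbar j (fun w => (((sqNorm fun i => g i w : ℝ) : ℂ))⁻¹) z =
        -(∑ i, G i * y i) / (q : ℂ) ^ 2 := by
      -- The derivative of `1/q` is read off from differentiating `q⁻¹ q = 1`.
      have h1 := dirDzbar_mul (a := Pi.single j 1) hinv hQ
      have h2 : (fun w => (((sqNorm fun i => g i w : ℝ) : ℂ))⁻¹ *
          ((sqNorm fun i => g i w : ℝ) : ℂ)) =ᶠ[nhds z] fun _ => 1 := by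
        filter_upwards [hQ.continuousAt.eventually_ne h0'] with w hw using inv_mul_cancel₀ hw
      rw [dzbar_eq_dirDzbar] at hdq ⊢
      rw [dirDzbar_congr h2, hdq] at h1
      have h3 : dirDzbar (Pi.single j 1) (fun _ => (1 : ℂ)) z = 0 := by simp [dirDzbar]
      rw [h3] at h1
      change _ = _ * (q : ℂ) + (q : ℂ)⁻¹ * _ at h1
      field_simp at h1 ⊢
      linear_combination -h1
    simp only [betaStar, div_eq_mul_inv (star (g l _))]
    rw [dzbar_eq_dirDzbar, dirDzbar_mul (hgr l).star hinv, dirDzbar_star (hgr l),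
      ← dz_eq_dirDz, ← dzbar_eq_dirDzbar, hinvd]
    change -(star (dz j (g l) z) * (q : ℂ)⁻¹ + star (G l) * _) = _
    simp only [hy]
    field_simp
    ring
  have hsum : ∑ l, ‖betaStar g z j l‖ ^ 2 =
      (sqNorm fun l => y l - star (G l) * ((∑ i, G i * y i) / (q : ℂ))) / q ^ 2 := by
    rw [sqNorm, Finset.sum_div]
    refine Finset.sum_congr rfl fun l _ => ?_
    rw [hb l, norm_div, norm_neg, div_pow, norm_real, Real.norm_eq_abs, sq_abs]
  rw [hsum]
  have hp := sqNorm_sub_projection G y h0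
  change sqNorm _ = sqNorm y - _ / q at hp
  change sqNorm (fun i => y i - star (G i) * ((∑ l, G l * y l) / (q : ℂ))) = _ at hp
  rw [hp]
  gcongr
  have : sqNorm y = ∑ l, ‖dz j (g l) z‖ ^ 2 := by
    simp [sqNorm, hy]
  rw [this]
  have : 0 ≤ ‖∑ l, G l * y l‖ ^ 2 / q := by positivity
  linarith

end SecondFundamentalForm

/-! ### The curvature operator for a weight with scalar Hessian. -/

section Curvature

variable {n k : ℕ} {g : Fin k → (Fin n → ℂ) → ℂ} {ψ : (Fin n → ℂ) → ℝ} {z : Fin n → ℂ} {s : ℝ}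

/-- When the Hessian of `ψ` is `s` times the identity, the curvature is `s Id - |g|² b b^*` with `b`
the coefficient vector of `β^*`. Nakano positivity and the inverse are then explicit. -/
theorem curv_eq (hg : ∀ i, DifferentiableAt ℝ (g i) z) (h0 : sqNorm (fun i => g i z) ≠ 0)
    (hψ : complexHessian ψ z = (s : ℂ) • 1) (j m : Fin n) (l p : Fin k) :
    curv ψ g z j m l p = (if (j, l) = (m, p) then (s : ℂ) else 0) -
      (sqNorm fun i => g i z : ℝ) * (betaStar g z m p * star (betaStar g z j l)) := by
  rw [curv, hψ, beta_eq hg h0]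
  simp only [Matrix.smul_apply, Matrix.one_apply, Prod.mk.injEq, smul_eq_mul, mul_ite, mul_one,
    mul_zero]
  congr 1
  · by_cases h1 : l = p <;> by_cases h2 : j = m <;> simp [h1, h2]
  · ring

theorem nakanoForm_curv (hg : ∀ i, DifferentiableAt ℝ (g i) z) (h0 : sqNorm (fun i => g i z) ≠ 0)
    (hψ : complexHessian ψ z = (s : ℂ) • 1) (u : Fin n → Fin k → ℂ) :
    (nakanoForm (curv ψ g z) u).re = s * ∑ x : Fin n × Fin k, ‖u x.1 x.2‖ ^ 2 -
      (sqNorm fun i => g i z) *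
        ‖∑ x : Fin n × Fin k, star (betaStar g z x.1 x.2) * u x.1 x.2‖ ^ 2 := by
  have h : nakanoForm (curv ψ g z) u = ∑ x : Fin n × Fin k, ∑ y : Fin n × Fin k,
      curv ψ g z x.1 y.1 x.2 y.2 * u x.1 x.2 * star (u y.1 y.2) := by
    simp only [nakanoForm, Fintype.sum_prod_type]
    refine Finset.sum_congr rfl fun j _ => ?_
    rw [Finset.sum_comm]
  have h2 : nakanoForm (curv ψ g z) u = ((s * ∑ x : Fin n × Fin k, ‖u x.1 x.2‖ ^ 2 -
      (sqNorm fun i => g i z) *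
        ‖∑ x : Fin n × Fin k, star (betaStar g z x.1 x.2) * u x.1 x.2‖ ^ 2 : ℝ) : ℂ) := by
    rw [h, ofReal_sub, ofReal_mul, ofReal_mul, ofReal_norm_sq, star_sum, Finset.sum_mul_sum,
      ofReal_sum, Finset.mul_sum, Finset.mul_sum, ← Finset.sum_sub_distrib]
    refine Finset.sum_congr rfl fun x _ => ?_
    simp only [curv_eq hg h0 hψ, sub_mul, Finset.sum_sub_distrib, Prod.mk.eta, ite_mul, zero_mul,
      Finset.sum_ite_eq, Finset.mem_univ, if_true]
    congr 1
    · rw [ofReal_norm_sq]; ring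
    · rw [Finset.mul_sum]
      refine Finset.sum_congr rfl fun y _ => ?_
      simp only [star_mul', star_star]
      ring
  rw [h2, ofReal_re]

/-- By Cauchy–Schwarz the rank-one part is at most `|g|² |b|²` times the identity. -/
theorem nakanoPositive_curv (hg : ∀ i, DifferentiableAt ℝ (g i) z)
    (h0 : sqNorm (fun i => g i z) ≠ 0) (hψ : complexHessian ψ z = (s : ℂ) • 1)
    (hs : (sqNorm fun i => g i z) * ∑ x : Fin n × Fin k, ‖betaStar g z x.1 x.2‖ ^ 2 < s) :
    NakanoPositive (curv ψ g z) := by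
  intro u hu
  rw [nakanoForm_curv hg h0 hψ]
  have hU : 0 < ∑ x : Fin n × Fin k, ‖u x.1 x.2‖ ^ 2 := by
    obtain ⟨j, hj⟩ := Function.ne_iff.1 hu
    obtain ⟨l, hl⟩ := Function.ne_iff.1 hj
    refine Finset.sum_pos' (fun _ _ => by positivity) ⟨(j, l), Finset.mem_univ _, ?_⟩
    have : 0 < ‖u j l‖ := norm_pos_iff.2 hl
    positivity
  have hcs := norm_sum_mul_sq_le (fun x : Fin n × Fin k => star (betaStar g z x.1 x.2))
    (fun x => u x.1 x.2)
  simp only [norm_star] at hcs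
  have hq := sqNorm_nonneg fun i => g i z
  nlinarith [mul_le_mul_of_nonneg_left hcs hq]

/-- The vector `b` is an eigenvector of the curvature operator with eigenvalue `s - |g|² |b|²`, so
the inverse acts on it as a scalar. -/
theorem curvTerm_eq (hg : ∀ i, DifferentiableAt ℝ (g i) z)
    (h0 : sqNorm (fun i => g i z) ≠ 0) (hψ : complexHessian ψ z = (s : ℂ) • 1) (hs0 : 0 < s)
    (hs : (sqNorm fun i => g i z) * ∑ x : Fin n × Fin k, ‖betaStar g z x.1 x.2‖ ^ 2 < s) :
    curvTerm ψ g z = (∑ x : Fin n × Fin k, ‖betaStar g z x.1 x.2‖ ^ 2) /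
      (s - (sqNorm fun i => g i z) * ∑ x : Fin n × Fin k, ‖betaStar g z x.1 x.2‖ ^ 2) := by
  set q : ℝ := sqNorm fun i => g i z with hq
  set b : Fin n × Fin k → ℂ := fun x => betaStar g z x.1 x.2 with hb
  set N : ℝ := ∑ x : Fin n × Fin k, ‖betaStar g z x.1 x.2‖ ^ 2 with hN
  have hNc : (N : ℂ) = b ⬝ᵥ star b := by
    simp only [hN, ofReal_sum, ofReal_norm_sq, dotProduct, Pi.star_apply, hb]
  set M := commLambda (curv ψ g z) with hM
  have hMv : ∀ v, M.mulVec v = (s : ℂ) • v - ((q : ℂ) * (star b ⬝ᵥ v)) • b := by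
    intro v
    ext x
    simp only [hM, Matrix.mulVec, dotProduct, commLambda, Matrix.of_apply, curv_eq hg h0 hψ,
      Prod.mk.eta, sub_mul, ite_mul, zero_mul, Finset.sum_sub_distrib, Finset.sum_ite_eq',
      Finset.mem_univ, if_true, Pi.sub_apply, Pi.smul_apply, smul_eq_mul]
    congr 1
    rw [Finset.mul_sum, Finset.sum_mul]
    refine Finset.sum_congr rfl fun y _ => ?_
    simp only [hb, Pi.star_apply, hq]
    ring
  have hs' : ((s - q * N : ℝ) : ℂ) ≠ 0 := by
    exact_mod_cast (sub_pos.2 hs).ne'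
  have hsc : (s : ℂ) ≠ 0 := by exact_mod_cast hs0.ne'
  have hbN : star b ⬝ᵥ b = N := by rw [hNc, dotProduct_comm]
  -- Pairing a kernel vector `v` with `b` gives `(s - q N)⟨v, b⟩ = 0`, hence `⟨v, b⟩ = 0`, and then
  -- `s v = 0`.
  have hdet : IsUnit M.det := by
    rw [isUnit_iff_ne_zero]
    intro h
    obtain ⟨v, hv, hMv0⟩ := Matrix.exists_mulVec_eq_zero_iff.2 h
    rw [hMv] at hMv0
    have h1 := congrArg (fun w => star b ⬝ᵥ w) hMv0
    simp only [dotProduct_sub, dotProduct_smul, smul_eq_mul, dotProduct_zero, hbN] at h1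
    have h2 : star b ⬝ᵥ v = 0 := by
      have : ((s - q * N : ℝ) : ℂ) * (star b ⬝ᵥ v) = 0 := by
        push_cast
        linear_combination h1
      exact (mul_eq_zero.1 this).resolve_left hs'
    rw [h2, mul_zero, zero_smul, sub_zero] at hMv0
    exact hv ((smul_eq_zero.1 hMv0).resolve_left hsc)
  have hinv : M⁻¹.mulVec b = ((s - q * N : ℝ) : ℂ)⁻¹ • b := by
    have h1 : M.mulVec (((s - q * N : ℝ) : ℂ)⁻¹ • b) = b := by
      rw [Matrix.mulVec_smul, hMv, hbN, ← sub_smul, smul_smul]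
      have : ((s - q * N : ℝ) : ℂ)⁻¹ * ((s : ℂ) - q * N) = 1 := by
        have := inv_mul_cancel₀ hs'
        push_cast at this ⊢
        exact this
      rw [this, one_smul]
    conv_lhs => rw [← h1]
    rw [Matrix.mulVec_mulVec, Matrix.nonsing_inv_mul _ hdet, Matrix.one_mulVec]
  have : curvTerm ψ g z = ((M⁻¹.mulVec b) ⬝ᵥ star b).re := rfl
  rw [this, hinv, smul_dotProduct, ← hNc, smul_eq_mul, ← ofReal_inv, ← ofReal_mul, ofReal_re]
  rw [div_eq_inv_mul]

end Curvature

/-! ### The test data: Gaussian weights and affine generators. -/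

/-- The weight `s |z - p|²`. -/
def gaussWeight {n : ℕ} (s : ℝ) (p z : Fin n → ℂ) : ℝ := s * sqNorm (fun j => z j - p j)

/-- The linear function `z ↦ ⟨z - p, a⟩`. -/
def linForm {n : ℕ} (a p z : Fin n → ℂ) : ℂ := ∑ j, star (a j) * (z j - p j)

/-- The tuple `(c ⟨z - p, a_1⟩, …, c ⟨z - p, a_r⟩, 1)`. -/
def linTuple {n r : ℕ} (c : ℝ) (a : Fin r → Fin n → ℂ) (p : Fin n → ℂ) :
    Fin (r + 1) → (Fin n → ℂ) → ℂ :=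
  Fin.snoc (α := fun _ => (Fin n → ℂ) → ℂ) (fun l z => c * linForm (a l) p z) (fun _ => 1)

section GaussWeight

variable {n : ℕ} {s : ℝ} {p : Fin n → ℂ}

theorem contDiff_gaussWeight {m : WithTop ℕ∞} : ContDiff ℝ m (gaussWeight s p) := by
  unfold gaussWeight sqNorm
  refine contDiff_const.mul (ContDiff.sum fun j _ => ContDiff.norm_sq ℝ ?_)
  exact (contDiff_apply ℝ ℂ j).sub contDiff_const

theorem gaussWeight_nonneg (hs : 0 ≤ s) (z : Fin n → ℂ) : 0 ≤ gaussWeight s p z :=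
  mul_nonneg hs (sqNorm_nonneg _)

theorem psh_gaussWeight (hs : 0 ≤ s) (D : Set (Fin n → ℂ)) : PSH D (gaussWeight s p) := by
  have hcont : Continuous (gaussWeight s p) := (contDiff_gaussWeight (m := 0)).continuous
  refine ⟨hcont.continuousOn.upperSemicontinuousOn, fun x b _ => ?_⟩
  -- The weight along the disc is `Re G` plus `s|ζ|²|b|² ≥ 0`; `Re G` is harmonic and its mean is
  -- its value at the centre.
  let κ : ℂ := ∑ j, 2 * star (x j - p j) * b j
  let G : ℂ → ℂ := fun ζ => (gaussWeight s p x : ℂ) + s * κ * ζ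
  have hG : Differentiable ℂ G := by fun_prop
  have havg : Real.circleAverage (reCLM ∘ G) 0 1 = gaussWeight s p x := by
    rw [ContinuousLinearMap.circleAverage_comp_comm reCLM
      (hG.continuous.continuousOn.circleIntegrable zero_le_one), hG.diffContOnCl.circleAverage]
    simp [G]
  rw [← havg]
  refine Real.circleAverage_mono ?_ ?_ fun ζ hζ => ?_
  · exact (reCLM.continuous.comp hG.continuous).continuousOn.circleIntegrable zero_le_one
  · exact (hcont.comp (by fun_prop : Continuous fun ζ : ℂ => x + ζ • b)).continuousOn.circleIntegrable
      zero_le_one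
  · have h1 : (reCLM ∘ G) ζ = s * ∑ j, (‖x j - p j‖ ^ 2 + (2 * star (x j - p j) * b j * ζ).re) := by
      simp only [Function.comp, reCLM_apply, G, add_re, ofReal_re, mul_assoc (s : ℂ), re_ofReal_mul,
        κ, Finset.sum_mul, re_sum, Finset.sum_add_distrib, gaussWeight, sqNorm]
      ring
    rw [h1, gaussWeight, sqNorm]
    refine mul_le_mul_of_nonneg_left (Finset.sum_le_sum fun j _ => ?_) hs
    have h2 : (x + ζ • b) j - p j = (x j - p j) + ζ * b j := by
      simp; ring
    rw [h2, ← Complex.normSq_eq_norm_sq, ← Complex.normSq_eq_norm_sq, Complex.normSq_add]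
    have h3 : (2 * star (x j - p j) * b j * ζ).re =
        2 * ((x j - p j) * (starRingEnd ℂ) (ζ * b j)).re := by
      rw [← Complex.conj_re ((x j - p j) * (starRingEnd ℂ) (ζ * b j))]
      simp only [map_mul, Complex.conj_conj, Complex.star_def]
      rw [← re_ofReal_mul]
      congr 1
      push_cast
      ring
    rw [h3]
    linarith [Complex.normSq_nonneg (ζ * b j)]

theorem dirDz_dirDzbar_gaussWeight (a b z : Fin n → ℂ) :
    dirDz a (dirDzbar b (fun w => (gaussWeight s p w : ℂ))) z =
      s * ∑ j, a j * star (b j) := by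
  have hco : ∀ (j : Fin n) (w : Fin n → ℂ), DifferentiableAt ℂ (fun w : Fin n → ℂ => w j - p j) w :=
    fun j w => by fun_prop
  have hcor : ∀ (j : Fin n) (w : Fin n → ℂ), DifferentiableAt ℝ (fun w : Fin n → ℂ => w j - p j) w :=
    fun j w => (hco j w).restrictScalars ℝ
  have h1 : dirDzbar b (fun w => (gaussWeight s p w : ℂ)) =
      fun w => ∑ j, (s : ℂ) * star (b j) * (w j - p j) := by
    ext w
    simp only [gaussWeight, ofReal_mul, ofReal_sqNorm]
    have hd : DifferentiableAt ℝ (fun w : Fin n → ℂ => ∑ j, (w j - p j) * star (w j - p j)) w :=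
      DifferentiableAt.fun_sum fun j _ => (hcor j w).mul (hcor j w).star
    rw [dirDzbar_const_mul _ hd,
      dirDzbar_sum (F := fun (j : Fin n) (w : Fin n → ℂ) => (w j - p j) * star (w j - p j)) _
        fun j _ => (hcor j w).mul (hcor j w).star, Finset.mul_sum]
    refine Finset.sum_congr rfl fun j _ => ?_
    rw [dirDzbar_mul (hcor j w) (hcor j w).star, dirDzbar_eq_zero (hco j w),
      dirDzbar_star (hcor j w), dirDz_sub_const, dirDz_coord]
    ring
  rw [h1, dirDz_sum (F := fun (j : Fin n) (w : Fin n → ℂ) => (s : ℂ) * star (b j) * (w j - p j)) _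
    fun j _ => (hcor j z).const_mul _, Finset.mul_sum]
  refine Finset.sum_congr rfl fun j _ => ?_
  rw [dirDz_const_mul _ (hcor j z), dirDz_sub_const, dirDz_coord]
  ring

theorem complexHessian_gaussWeight (z : Fin n → ℂ) :
    complexHessian (gaussWeight s p) z = (s : ℂ) • 1 := by
  ext j k
  rw [complexHessian, Matrix.of_apply, dz_eq_dirDz]
  have : dzbar k (fun w => (gaussWeight s p w : ℂ)) =
      dirDzbar (Pi.single k 1) (fun w => (gaussWeight s p w : ℂ)) := by
    ext w; exact dzbar_eq_dirDzbar k
  rw [this, dirDz_dirDzbar_gaussWeight]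
  simp [Matrix.one_apply, Pi.single_apply, eq_comm]

theorem leviForm_add_gaussWeight {D : Set (Fin n → ℂ)} {φ : (Fin n → ℂ) → ℝ} (hD : IsOpen D)
    (hφ : ContDiffOn ℝ 2 φ D) {z : Fin n → ℂ} (hz : z ∈ D) (a : Fin n → ℂ) :
    leviForm (fun w => φ w + gaussWeight s p w) a z = leviForm φ a z + s * sqNorm a := by
  have hU := contDiffOn_ofReal hφ
  have hG : ContDiffOn ℝ 2 (fun w => (gaussWeight s p w : ℂ)) D :=
    contDiffOn_ofReal contDiff_gaussWeight.contDiffOn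
  have h1 : dirDzbar a (fun w => ((φ w + gaussWeight s p w : ℝ) : ℂ)) =ᶠ[nhds z]
      fun w => dirDzbar a (fun w => (φ w : ℂ)) w +
        dirDzbar a (fun w => (gaussWeight s p w : ℂ)) w := by
    filter_upwards [hD.mem_nhds hz] with w hw
    have hn := hD.mem_nhds hw
    simp only [ofReal_add]
    exact dirDzbar_add ((hU.differentiableOn (by norm_num)).differentiableAt hn)
      ((hG.differentiableOn (by norm_num)).differentiableAt hn)
  have hn := hD.mem_nhds hz
  rw [leviForm, dirDz_congr h1, dirDz_add, dirDz_dirDzbar_gaussWeight, ← ofReal_sqNorm, add_re,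
    ← ofReal_mul, ofReal_re, leviForm]
  · exact ((contDiffOn_dirDzbar (k := 1) hD hU (by norm_num)).differentiableOn
      (by norm_num)).differentiableAt hn
  · exact ((contDiffOn_dirDzbar (k := 1) hD hG (by norm_num)).differentiableOn
      (by norm_num)).differentiableAt hn

end GaussWeight

section LinTuple

variable {n r : ℕ} {c : ℝ} {a : Fin r → Fin n → ℂ} {p : Fin n → ℂ}

@[simp] theorem linTuple_castSucc (l : Fin r) :
    linTuple c a p l.castSucc = fun z => c * linForm (a l) p z := by
  simp [linTuple]

@[simp] theorem linTuple_last : linTuple c a p (Fin.last r) = fun _ => 1 := by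
  simp [linTuple]

theorem differentiable_linForm (b : Fin n → ℂ) : Differentiable ℂ (linForm b p) := by
  unfold linForm
  fun_prop

theorem dirDz_linForm (b v z : Fin n → ℂ) : dirDz v (linForm b p) z = ∑ j, star (b j) * v j := by
  have hco : ∀ j : Fin n, DifferentiableAt ℝ (fun w : Fin n → ℂ => w j - p j) z :=
    fun j => by fun_prop
  unfold linForm
  rw [dirDz_sum (F := fun (j : Fin n) (w : Fin n → ℂ) => star (b j) * (w j - p j)) _
    fun j _ => (hco j).const_mul _]
  exact Finset.sum_congr rfl fun j _ => by
    rw [dirDz_const_mul _ (hco j), dirDz_sub_const, dirDz_coord]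

theorem differentiable_linTuple (i : Fin (r + 1)) : Differentiable ℂ (linTuple c a p i) := by
  refine Fin.lastCases ?_ (fun l => ?_) i
  · simp
  · simpa using (differentiable_linForm (a l)).const_mul (c : ℂ)

theorem sqNorm_linTuple (z : Fin n → ℂ) :
    sqNorm (fun i => linTuple c a p i z) = c ^ 2 * (∑ l, ‖linForm (a l) p z‖ ^ 2) + 1 := by
  rw [sqNorm, Fin.sum_univ_castSucc]
  simp [mul_pow, Finset.mul_sum]

theorem one_le_sqNorm_linTuple (z : Fin n → ℂ) : 1 ≤ sqNorm (fun i => linTuple c a p i z) := by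
  rw [sqNorm_linTuple]
  have : 0 ≤ c ^ 2 * (∑ l, ‖linForm (a l) p z‖ ^ 2) := by positivity
  linarith

theorem sum_norm_dz_linTuple (ha : ∀ l, sqNorm (a l) = 1) (z : Fin n → ℂ) :
    ∑ j, ∑ i, ‖dz j (linTuple c a p i) z‖ ^ 2 = c ^ 2 * r := by
  have h : ∀ (j : Fin n) (l : Fin r), ‖dz j (linTuple c a p l.castSucc) z‖ ^ 2 =
      c ^ 2 * ‖a l j‖ ^ 2 := by
    intro j l
    rw [linTuple_castSucc, dz_eq_dirDz,
      dirDz_const_mul _ ((differentiable_linForm (a l) z).restrictScalars ℝ), dirDz_linForm]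
    simp [Pi.single_apply, mul_pow]
  have hlast : ∀ j, dz j (linTuple c a p (Fin.last r)) z = 0 := by
    intro j
    simp [dz]
  simp only [Fin.sum_univ_castSucc, h, hlast]
  simp only [norm_zero, ne_eq, OfNat.ofNat_ne_zero, not_false_eq_true, zero_pow, add_zero]
  rw [Finset.sum_comm]
  simp only [← Finset.mul_sum]
  simp only [sqNorm] at ha
  simp [ha]

/-- The constant last generator forces `|g| ≥ 1`, and the derivatives of `g` have total square norm
`c²r`, so both bounds are uniform in `z`. -/
theorem sqNorm_mul_sum_betaStar_linTuple_le (ha : ∀ l, sqNorm (a l) = 1) (z : Fin n → ℂ) :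
    sqNorm (fun i => linTuple c a p i z) *
        ∑ x : Fin n × Fin (r + 1), ‖betaStar (linTuple c a p) z x.1 x.2‖ ^ 2 ≤ c ^ 2 * r ∧
      ∑ x : Fin n × Fin (r + 1), ‖betaStar (linTuple c a p) z x.1 x.2‖ ^ 2 ≤ c ^ 2 * r := by
  have hq := one_le_sqNorm_linTuple (c := c) (a := a) (p := p) z
  have h := sum_norm_betaStar_sq_le (g := linTuple c a p) (z := z)
    (fun i => differentiable_linTuple i z) (by linarith)
  rw [sum_norm_dz_linTuple ha] at h
  set q := sqNorm fun i => linTuple c a p i z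
  have hB : 0 ≤ ∑ x : Fin n × Fin (r + 1), ‖betaStar (linTuple c a p) z x.1 x.2‖ ^ 2 :=
    Finset.sum_nonneg fun _ _ => by positivity
  set B := ∑ x : Fin n × Fin (r + 1), ‖betaStar (linTuple c a p) z x.1 x.2‖ ^ 2
  have hq2 : 0 < q ^ 2 := by positivity
  rw [le_div_iff₀ hq2] at h
  have h2 : q * B ≤ c ^ 2 * r := by nlinarith [mul_nonneg hB (by linarith : 0 ≤ q)]
  exact ⟨h2, by nlinarith⟩

theorem nakanoPositive_linTuple {s : ℝ} (hs : c ^ 2 * r < s) (ha : ∀ l, sqNorm (a l) = 1)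
    (z : Fin n → ℂ) : NakanoPositive (curv (gaussWeight s p) (linTuple c a p) z) :=
  nakanoPositive_curv (fun i => (differentiable_linTuple i z).restrictScalars ℝ)
    (by linarith [one_le_sqNorm_linTuple (c := c) (a := a) (p := p) z])
    (complexHessian_gaussWeight z)
    ((sqNorm_mul_sum_betaStar_linTuple_le ha z).1.trans_lt hs)

theorem curvTerm_linTuple_le {s : ℝ} (hs : c ^ 2 * r < s) (ha : ∀ l, sqNorm (a l) = 1)
    (z : Fin n → ℂ) :
    curvTerm (gaussWeight s p) (linTuple c a p) z ≤ c ^ 2 * r / (s - c ^ 2 * r) := by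
  have hb := sqNorm_mul_sum_betaStar_linTuple_le (c := c) (p := p) ha z
  have h0 : 0 ≤ c ^ 2 * r := by positivity
  rw [curvTerm_eq (fun i => (differentiable_linTuple i z).restrictScalars ℝ)
    (by linarith [one_le_sqNorm_linTuple (c := c) (a := a) (p := p) z])
    (complexHessian_gaussWeight z) (by linarith) (hb.1.trans_lt hs)]
  exact div_le_div₀ h0 hb.2 (by linarith) (by linarith [hb.1])

/-- On the frame `a` itself the Jacobian matrix is `c` times the identity, by orthonormality. -/
theorem wedgeD_linTuple_ne_zero (hc : c ≠ 0)
    (ha : ∀ l m, ∑ j, star (a l j) * a m j = if l = m then 1 else 0) (z : Fin n → ℂ) :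
    wedgeD (fun i : Fin r => linTuple c a p i.castSucc) z a ≠ 0 := by
  have h : (Matrix.of fun i j => fderiv ℂ (linTuple c a p (Fin.castSucc i)) z (a j) :
      Matrix (Fin r) (Fin r) ℂ) = (c : ℂ) • 1 := by
    ext i j
    rw [Matrix.of_apply, ← dirDz_eq_fderiv (differentiable_linTuple _ z), linTuple_castSucc,
      dirDz_const_mul _ ((differentiable_linForm (a i) z).restrictScalars ℝ), dirDz_linForm, ha]
    simp [Matrix.one_apply]
  rw [wedgeD, h, Matrix.det_smul, Matrix.det_one, mul_one]
  exact pow_ne_zero _ (by exact_mod_cast hc)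

end LinTuple

/-! ### The division estimate for the test data, tested by duality. -/

/-- Every admissible division problem for `f` has a solution with the `L²` estimate. -/
def SkodaDivision {n : ℕ} (r : ℕ) (D : Set (Fin n → ℂ)) (φ : (Fin n → ℂ) → ℝ)
    (f : (Fin n → ℂ) → ℂ) : Prop :=
  ∀ (g : Fin (r + 1) → (Fin n → ℂ) → ℂ) (ψ : (Fin n → ℂ) → ℝ),
    (∀ i, DifferentiableOn ℂ (g i) D) →
    (∀ z ∈ D, ∃ i, g i z ≠ 0) →
    (∀ z ∈ D, ∃ v : Fin r → Fin n → ℂ, wedgeD (fun i : Fin r => g i.castSucc) z v ≠ 0) →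
    ContDiffOn ℝ ∞ ψ D →
    PSH D ψ →
    (∀ z ∈ D, NakanoPositive (curv ψ g z)) →
    skodaI D φ ψ g f < ⊤ →
    ∃ h : Fin (r + 1) → (Fin n → ℂ) → ℂ,
      (∀ i, DifferentiableOn ℂ (h i) D) ∧
      (∀ z ∈ D, f z = ∑ i, g i z * h i z) ∧
      normSq D (fun z => φ z + ψ z) h ≤ skodaI D φ ψ g f

section Division

variable {n r : ℕ} {D : Set (Fin n → ℂ)} {φ : (Fin n → ℂ) → ℝ} {f : (Fin n → ℂ) → ℂ}
  {a : Fin r → Fin n → ℂ} {p : Fin n → ℂ} {s c : ℝ}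

theorem continuousOn_exp_neg_add_gaussWeight (hφ : ContinuousOn φ D) :
    ContinuousOn (fun z => Real.exp (-(φ z + gaussWeight s p z))) D :=
  (hφ.add (contDiff_gaussWeight (m := 0)).continuous.continuousOn).neg.rexp

theorem MemA2.integrableOn (hD : IsOpen D) (hφ : ContinuousOn φ D) (hf : MemA2 D φ f) :
    IntegrableOn (fun z => ‖f z‖ ^ 2 * Real.exp (-φ z)) D := by
  refine ⟨ContinuousOn.aestronglyMeasurable
    ((hf.1.continuousOn.norm.pow 2).mul hφ.neg.rexp) hD.measurableSet, ?_⟩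
  rw [hasFiniteIntegral_iff_ofReal (Filter.Eventually.of_forall fun z => by positivity)]
  exact hf.2

theorem MemA2.add_gaussWeight (hD : IsOpen D) (hφ : ContinuousOn φ D) (hf : MemA2 D φ f)
    (hs : 0 ≤ s) : IntegrableOn (fun z => ‖f z‖ ^ 2 * Real.exp (-(φ z + gaussWeight s p z))) D := by
  refine (hf.integrableOn hD hφ).mono' (ContinuousOn.aestronglyMeasurable
    ((hf.1.continuousOn.norm.pow 2).mul (continuousOn_exp_neg_add_gaussWeight hφ))
    hD.measurableSet) (Filter.Eventually.of_forall fun z => ?_)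
  rw [Real.norm_of_nonneg (by positivity)]
  gcongr
  linarith [gaussWeight_nonneg (p := p) hs z]

/-- The hypothesis for the affine generators, in real-valued integrals and with the curvature term
replaced by its uniform bound. Comparing with `∫ |f|² e^{-φ}` shows that `skodaI` is finite. -/
theorem SkodaDivision.exists_division (hdiv : SkodaDivision r D φ f) (hD : IsOpen D)
    (hφ : ContinuousOn φ D) (hf : MemA2 D φ f)
    (ha : ∀ l m, ∑ j, star (a l j) * a m j = if l = m then 1 else 0)
    (hc : c ≠ 0) (hcs : c ^ 2 * r < s) :
    ∃ h : Fin (r + 1) → (Fin n → ℂ) → ℂ,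
      (∀ i, DifferentiableOn ℂ (h i) D) ∧
      (∀ z ∈ D, f z = ∑ i, linTuple c a p i z * h i z) ∧
      IntegrableOn (fun z => sqNorm (fun i => h i z) *
        Real.exp (-(φ z + gaussWeight s p z))) D ∧
      ∫ z in D, sqNorm (fun i => h i z) * Real.exp (-(φ z + gaussWeight s p z)) ≤
        ∫ z in D, (1 / sqNorm (fun i => linTuple c a p i z) + c ^ 2 * r / (s - c ^ 2 * r)) *
          (‖f z‖ ^ 2 * Real.exp (-(φ z + gaussWeight s p z))) := by
  have hcr : 0 ≤ c ^ 2 * r := by positivity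
  have hs : 0 ≤ s := by linarith
  have ha1 := sqNorm_eq_one ha
  have hN := hf.add_gaussWeight (p := p) hD hφ hs
  have hqc : Continuous fun z => sqNorm (fun i => linTuple c a p i z) := by
    unfold sqNorm
    exact continuous_finsetSum _ fun i _ => (differentiable_linTuple i).continuous.norm.pow 2
  have hq1 := one_le_sqNorm_linTuple (c := c) (a := a) (p := p)
  set κ : ℝ := c ^ 2 * r / (s - c ^ 2 * r)
  have hκ0 : 0 ≤ κ := div_nonneg hcr (by linarith)
  have hR : IntegrableOn (fun z => (1 / sqNorm (fun i => linTuple c a p i z) + κ) *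
      (‖f z‖ ^ 2 * Real.exp (-(φ z + gaussWeight s p z)))) D := by
    refine Integrable.bdd_mul (c := 1 + κ) hN ?_ (Filter.Eventually.of_forall fun z => ?_)
    · exact ((continuous_const.div hqc fun z => by linarith [hq1 z]).add
        continuous_const).aestronglyMeasurable
    · have h0 : 0 < sqNorm (fun i => linTuple c a p i z) := by linarith [hq1 z]
      rw [Real.norm_of_nonneg (by positivity)]
      gcongr
      exact (div_le_one h0).2 (hq1 z)
  have hIle : skodaI D φ (gaussWeight s p) (linTuple c a p) f ≤
      ENNReal.ofReal (∫ z in D, (1 / sqNorm (fun i => linTuple c a p i z) + κ) *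
        (‖f z‖ ^ 2 * Real.exp (-(φ z + gaussWeight s p z)))) := by
    rw [ofReal_integral_eq_lintegral_ofReal hR (Filter.Eventually.of_forall fun z => by
      have := sqNorm_nonneg (fun i => linTuple c a p i z)
      show 0 ≤ (1 / sqNorm (fun i => linTuple c a p i z) + κ) *
        (‖f z‖ ^ 2 * Real.exp (-(φ z + gaussWeight s p z)))
      positivity), skodaI]
    refine lintegral_mono fun z => ENNReal.ofReal_le_ofReal ?_
    rw [mul_assoc, neg_add']
    gcongr
    exact curvTerm_linTuple_le hcs ha1 z
  obtain ⟨h, hh, hfh, hle⟩ := hdiv (linTuple c a p) (gaussWeight s p)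
    (fun i => (differentiable_linTuple i).differentiableOn)
    (fun z _ => ⟨Fin.last r, by simp⟩)
    (fun z _ => ⟨a, wedgeD_linTuple_ne_zero hc ha z⟩)
    contDiff_gaussWeight.contDiffOn (psh_gaussWeight hs D)
    (fun z _ => nakanoPositive_linTuple hcs ha1 z)
    (hIle.trans_lt ENNReal.ofReal_lt_top)
  have hle' := hle.trans hIle
  rw [normSq] at hle'
  have hnn : ∀ z, 0 ≤ sqNorm (fun i => h i z) * Real.exp (-(φ z + gaussWeight s p z)) :=
    fun z => mul_nonneg (sqNorm_nonneg _) (Real.exp_pos _).le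
  have hint : IntegrableOn (fun z => sqNorm (fun i => h i z) *
      Real.exp (-(φ z + gaussWeight s p z))) D := by
    refine ⟨ContinuousOn.aestronglyMeasurable (ContinuousOn.mul ?_
      (continuousOn_exp_neg_add_gaussWeight hφ)) hD.measurableSet, ?_⟩
    · unfold sqNorm
      exact continuousOn_finsetSum _ fun i _ => (hh i).continuousOn.norm.pow 2
    · rw [hasFiniteIntegral_iff_ofReal (Filter.Eventually.of_forall hnn)]
      exact hle'.trans_lt ENNReal.ofReal_lt_top
  refine ⟨h, hh, hfh, hint, ?_⟩
  rw [← ofReal_integral_eq_lintegral_ofReal hint (Filter.Eventually.of_forall hnn)] at hle'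
  refine (ENNReal.ofReal_le_ofReal_iff (integral_nonneg fun z => ?_)).1 hle'
  have := sqNorm_nonneg (fun i => linTuple c a p i z)
  show 0 ≤ (1 / sqNorm (fun i => linTuple c a p i z) + κ) *
    (‖f z‖ ^ 2 * Real.exp (-(φ z + gaussWeight s p z)))
  positivity

/-- The estimate obtained by testing the division problem with parameter `c` against
twisted derivatives. -/
theorem SkodaDivision.test_inequality (hdiv : SkodaDivision r D φ f) (hD : IsOpen D)
    (hφ : ContDiffOn ℝ 2 φ D) (hf : MemA2 D φ f)
    (ha : ∀ l m, ∑ j, star (a l j) * a m j = if l = m then 1 else 0)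
    (hc : c ≠ 0) (hcs : c ^ 2 * r < s)
    {α : (Fin n → ℂ) → ℂ} (hα : ContDiffOn ℝ 2 α D) (hαc : HasCompactSupport α)
    (hαs : tsupport α ⊆ D) (t : ℝ) :
    -(2 * t) * (∑ l, (∫ z, (1 / (sqNorm (fun i => linTuple c a p i z) : ℂ)) *
      ((f z * star (linForm (a l) p z)) *
        (star (twistedDz (fun z => φ z + gaussWeight s p z) (a l) α z) *
          exp (-((φ z + gaussWeight s p z : ℝ) : ℂ))))).re) -
      t ^ 2 * ∑ l, ∫ z, ‖twistedDz (fun z => φ z + gaussWeight s p z) (a l) α z‖ ^ 2 *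
        Real.exp (-(φ z + gaussWeight s p z)) ≤
    r / (s - c ^ 2 * r) * ∫ z in D, ‖f z‖ ^ 2 * Real.exp (-(φ z + gaussWeight s p z)) := by
  have hcr : 0 ≤ c ^ 2 * r := by positivity
  have hs : 0 ≤ s := by linarith
  obtain ⟨h, hh, hfh, hint, hle⟩ :=
    hdiv.exists_division (p := p) hD hφ.continuousOn hf ha hc hcs
  set Φ : (Fin n → ℂ) → ℝ := fun z => φ z + gaussWeight s p z
  have hΦ : ContDiffOn ℝ 2 Φ D := hφ.add contDiff_gaussWeight.contDiffOn
  have hN := hf.add_gaussWeight (p := p) hD hφ.continuousOn hs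
  set q : (Fin n → ℂ) → ℝ := fun z => sqNorm (fun i => linTuple c a p i z) with hq
  have hq1 : ∀ z, 1 ≤ q z := one_le_sqNorm_linTuple
  have hqc : Continuous q := by
    simp only [hq, sqNorm]
    exact continuous_finsetSum _ fun i _ => (differentiable_linTuple i).continuous.norm.pow 2
  set w : Fin r → (Fin n → ℂ) → ℂ := fun l => twistedDz Φ (a l) α
  have hws : ∀ l, tsupport (w l) ⊆ tsupport α := fun l => tsupport_twistedDz_subset (a l)
  have hwcont : ∀ l, ContinuousOn (w l) D := fun l =>
    (contDiffOn_twistedDz hD hΦ hα (a l)).continuousOn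
  have hW : ContinuousOn (fun z => exp (-((Φ z : ℝ) : ℂ))) D := (contDiffOn_weight hΦ).continuousOn
  have hwE : ∀ l, ContinuousOn (fun z => star (w l z) * exp (-((Φ z : ℝ) : ℂ))) D := fun l =>
    (continuous_star.comp_continuousOn (hwcont l)).mul hW
  have hwEs : ∀ l, tsupport (fun z => star (w l z) * exp (-((Φ z : ℝ) : ℂ))) ⊆ tsupport α :=
    fun l => (tsupport_star_mul_subset _).trans (hws l)
  have hwEc : ∀ l, HasCompactSupport (fun z => star (w l z) * exp (-((Φ z : ℝ) : ℂ))) :=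
    fun l => hαc.mono' (subset_closure.trans (hwEs l))
  -- integrability of the test terms
  have hvint : ∀ {v : (Fin n → ℂ) → ℂ} (_ : ContinuousOn v D) (l : Fin r),
      Integrable fun z => v z * (star (w l z) * exp (-((Φ z : ℝ) : ℂ))) := fun hv l =>
    integrable_of_continuousOn_of_tsupport_subset (hv.mul (hwE l)) (hwEc l).mul_left
      ((tsupport_mul_subset_right).trans ((hwEs l).trans hαs))
  have hw2int : ∀ l, Integrable fun z => ‖w l z‖ ^ 2 * Real.exp (-Φ z) := by
    intro l
    have := (hvint (hwcont l) l)
    simp only [mul_star_mul_weight] at this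
    exact this.re
  -- Here `c v₀ l` is the `l`-th component of the pointwise minimal solution `f conj(g)/|g|²`.
  set v₀ : Fin r → (Fin n → ℂ) → ℂ := fun l z =>
    (1 / (q z : ℂ)) * (f z * star (linForm (a l) p z)) with hv₀
  have hv₀c : ∀ l, ContinuousOn (v₀ l) D := by
    intro l
    refine ContinuousOn.mul (Continuous.continuousOn ?_) (hf.1.continuousOn.mul ?_)
    · exact continuous_const.div (continuous_ofReal.comp hqc) fun z => by
        have : q z ≠ 0 := by linarith [hq1 z]
        simpa using this
    · exact (continuous_star.comp (differentiable_linForm (a l)).continuous).continuousOn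
  -- The adjoint relation moves the derivative onto the holomorphic `h_l`, where it vanishes.
  have horth : ∀ l, ∫ z, h l.castSucc z * (star (w l z) * exp (-((Φ z : ℝ) : ℂ))) = 0 := by
    intro l
    rw [integral_mul_star_twistedDz hD (hΦ.of_le (by norm_num)) (hα.of_le (by norm_num)) hαc hαs
      (by exact_mod_cast contDiffOn_real_of_differentiableOn hD (hh l.castSucc) 1)]
    rw [neg_eq_zero]
    refine integral_eq_zero_of_ae (Filter.Eventually.of_forall fun z => ?_)
    by_cases hz : z ∈ D
    · simp [dirDzbar_eq_zero ((hh l.castSucc).differentiableAt (hD.mem_nhds hz))]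
    · simp [image_eq_zero_of_notMem_tsupport fun h => hz (hαs h)]
  -- the pointwise inequality
  have hpt : ∀ z ∈ D, (1 / q z) * (‖f z‖ ^ 2 * Real.exp (-Φ z)) +
      ∑ l, ((2 * c * t) * ((h l.castSucc z - c * v₀ l z) *
          (star (w l z) * exp (-((Φ z : ℝ) : ℂ)))).re -
        c ^ 2 * t ^ 2 * (‖w l z‖ ^ 2 * Real.exp (-Φ z))) ≤
      sqNorm (fun i => h i z) * Real.exp (-Φ z) := by
    intro z hz
    have hq0 : q z ≠ 0 := by linarith [hq1 z]
    have hproj := sqNorm_sub_projection (fun i => linTuple c a p i z) (fun i => h i z) hq0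
    rw [← hfh z hz] at hproj
    have hlow : ∑ l : Fin r, ‖h l.castSucc z - c * v₀ l z‖ ^ 2 ≤
        sqNorm (fun i => h i z) - ‖f z‖ ^ 2 / q z := by
      rw [← hproj, sqNorm, Fin.sum_univ_castSucc]
      refine le_add_of_le_of_nonneg (Finset.sum_le_sum fun l _ => le_of_eq ?_) (by positivity)
      simp only [linTuple_castSucc, hv₀, star_mul', Complex.star_def, conj_ofReal]
      congr 2
      ring
    have hterm : ∀ l : Fin r, (2 * c * t) * ((h l.castSucc z - c * v₀ l z) *
          (star (w l z) * exp (-((Φ z : ℝ) : ℂ)))).re -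
        c ^ 2 * t ^ 2 * (‖w l z‖ ^ 2 * Real.exp (-Φ z)) ≤
        ‖h l.castSucc z - c * v₀ l z‖ ^ 2 * Real.exp (-Φ z) := by
      intro l
      set x := h l.castSucc z - c * v₀ l z
      have he : exp (-((Φ z : ℝ) : ℂ)) = ((Real.exp (-Φ z) : ℝ) : ℂ) := by push_cast; rfl
      rw [he, ← mul_assoc, re_mul_ofReal]
      have h1 : 0 ≤ ‖x - ((c * t : ℝ) : ℂ) * w l z‖ ^ 2 := by positivity
      have h2 : ‖x - ((c * t : ℝ) : ℂ) * w l z‖ ^ 2 =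
          ‖x‖ ^ 2 - 2 * (c * t) * (x * star (w l z)).re + (c * t) ^ 2 * ‖w l z‖ ^ 2 := by
        simp only [← Complex.normSq_eq_norm_sq]
        rw [Complex.normSq_sub, Complex.normSq_mul, Complex.normSq_ofReal, map_mul, conj_ofReal,
          mul_left_comm x, re_ofReal_mul, Complex.star_def]
        ring
      have h3 := (Real.exp_pos (-Φ z)).le
      rw [h2] at h1
      nlinarith [mul_nonneg h1 h3]
    have hsum := Finset.sum_le_sum fun l (_ : l ∈ Finset.univ) => hterm l
    rw [← Finset.sum_mul] at hsum
    have h3 := (Real.exp_pos (-Φ z)).le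
    have h4 := mul_le_mul_of_nonneg_right hlow h3
    have h5 : (sqNorm (fun i => h i z) - ‖f z‖ ^ 2 / q z) * Real.exp (-Φ z) =
        sqNorm (fun i => h i z) * Real.exp (-Φ z) - (1 / q z) * (‖f z‖ ^ 2 * Real.exp (-Φ z)) := by
      ring
    linarith
  -- integrate
  have hint1 : IntegrableOn (fun z => (1 / q z) * (‖f z‖ ^ 2 * Real.exp (-Φ z))) D := by
    refine Integrable.bdd_mul (c := 1) hN ?_ (Filter.Eventually.of_forall fun z => ?_)
    · exact (continuous_const.div hqc fun z => by linarith [hq1 z]).aestronglyMeasurable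
    · have h0 : 0 < q z := by linarith [hq1 z]
      rw [Real.norm_of_nonneg (by positivity)]
      exact (div_le_one h0).2 (hq1 z)
  have hint2 : ∀ l : Fin r, Integrable (fun z => (h l.castSucc z - c * v₀ l z) *
      (star (w l z) * exp (-((Φ z : ℝ) : ℂ)))) := fun l =>
    hvint ((hh l.castSucc).continuousOn.sub (continuousOn_const.mul (hv₀c l))) l
  have hint2r : ∀ l : Fin r, Integrable (fun z => ((h l.castSucc z - c * v₀ l z) *
      (star (w l z) * exp (-((Φ z : ℝ) : ℂ)))).re) := fun l => (hint2 l).re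
  have hint3 : ∀ l : Fin r, Integrable (fun z => (2 * c * t) * ((h l.castSucc z - c * v₀ l z) *
      (star (w l z) * exp (-((Φ z : ℝ) : ℂ)))).re -
        c ^ 2 * t ^ 2 * (‖w l z‖ ^ 2 * Real.exp (-Φ z))) := fun l =>
    ((hint2r l).const_mul _).sub ((hw2int l).const_mul _)
  have hval : ∀ l : Fin r, ∫ z in D, ((2 * c * t) * ((h l.castSucc z - c * v₀ l z) *
      (star (w l z) * exp (-((Φ z : ℝ) : ℂ)))).re -
        c ^ 2 * t ^ 2 * (‖w l z‖ ^ 2 * Real.exp (-Φ z))) =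
      c ^ 2 * (-(2 * t) * (∫ z, v₀ l z * (star (w l z) * exp (-((Φ z : ℝ) : ℂ)))).re -
        t ^ 2 * ∫ z, ‖w l z‖ ^ 2 * Real.exp (-Φ z)) := by
    intro l
    rw [setIntegral_eq_integral_of_forall_compl_eq_zero]
    · have e1 : ∫ z, (h l.castSucc z - c * v₀ l z) * (star (w l z) * exp (-((Φ z : ℝ) : ℂ))) =
          -c * ∫ z, v₀ l z * (star (w l z) * exp (-((Φ z : ℝ) : ℂ))) := by
        simp only [sub_mul, mul_assoc (c : ℂ)]
        rw [integral_sub (hvint (hh l.castSucc).continuousOn l) ((hvint (hv₀c l) l).const_mul _),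
          horth, integral_const_mul]
        ring
      have e2 : ∫ z, ((h l.castSucc z - c * v₀ l z) *
          (star (w l z) * exp (-((Φ z : ℝ) : ℂ)))).re =
          -c * (∫ z, v₀ l z * (star (w l z) * exp (-((Φ z : ℝ) : ℂ)))).re := by
        have := reCLM.integral_comp_comm (hint2 l)
        simp only [reCLM_apply] at this
        rw [this, e1, ← ofReal_neg, re_ofReal_mul]
      rw [integral_sub ((hint2r l).const_mul _) ((hw2int l).const_mul _)]
      simp only [integral_const_mul]
      rw [e2]
      ring
    · intro z hz
      have : w l z = 0 := image_eq_zero_of_notMem_tsupport fun h => hz (hαs (hws l h))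
      simp [this]
  have hmono := setIntegral_mono_on (hint1.add (integrable_finsetSum _ fun l _ =>
    (hint3 l).integrableOn)) hint hD.measurableSet hpt
  have hsplit : ∫ z in D, ((1 / q z) * (‖f z‖ ^ 2 * Real.exp (-Φ z)) +
      ∑ l, ((2 * c * t) * ((h l.castSucc z - c * v₀ l z) *
          (star (w l z) * exp (-((Φ z : ℝ) : ℂ)))).re -
        c ^ 2 * t ^ 2 * (‖w l z‖ ^ 2 * Real.exp (-Φ z)))) =
      (∫ z in D, (1 / q z) * (‖f z‖ ^ 2 * Real.exp (-Φ z))) +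
      ∑ l, c ^ 2 * (-(2 * t) * (∫ z, v₀ l z * (star (w l z) * exp (-((Φ z : ℝ) : ℂ)))).re -
        t ^ 2 * ∫ z, ‖w l z‖ ^ 2 * Real.exp (-Φ z)) := by
    rw [integral_add hint1 (integrable_finsetSum _ fun l _ => (hint3 l).integrableOn),
      integral_finsetSum _ fun l _ => (hint3 l).integrableOn]
    simp only [hval]
  have hmono' := hsplit.symm.le.trans (hmono.trans hle)
  have hrhs : ∫ z in D, (1 / q z + c ^ 2 * r / (s - c ^ 2 * r)) *
      (‖f z‖ ^ 2 * Real.exp (-Φ z)) = (∫ z in D, (1 / q z) * (‖f z‖ ^ 2 * Real.exp (-Φ z))) +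
      c ^ 2 * (r / (s - c ^ 2 * r) * ∫ z in D, ‖f z‖ ^ 2 * Real.exp (-Φ z)) := by
    simp only [add_mul]
    rw [integral_add hint1 (hN.const_mul _), integral_const_mul]
    ring
  -- The integrals of `|f|²/|g|²` now cancel, and everything left carries the factor `c²`.
  rw [hrhs] at hmono'
  rw [← Finset.mul_sum] at hmono'
  have hc2 : 0 < c ^ 2 := by positivity
  have := le_of_mul_le_mul_left (le_of_add_le_add_left hmono') hc2
  rw [Finset.sum_sub_distrib, ← Finset.mul_sum, ← Finset.mul_sum] at this
  simpa only [hv₀, mul_assoc] using this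

end Division

/-! ### The limit `c → 0` and the cut-off inequality. -/

section Limit

open Filter Topology

variable {n r : ℕ} {D : Set (Fin n → ℂ)} {φ : (Fin n → ℂ) → ℝ} {f : (Fin n → ℂ) → ℂ}
  {a : Fin r → Fin n → ℂ} {p : Fin n → ℂ} {s : ℝ}

/-- For a unit vector `b`, `∂̄_b(f conj⟨z-p,b⟩) = f`; the adjoint relation does the rest. -/
theorem integral_linForm_mul_star_twistedDz (hD : IsOpen D) {u : (Fin n → ℂ) → ℝ}
    (hu : ContDiffOn ℝ 1 u D) (hf : DifferentiableOn ℂ f D) {b : Fin n → ℂ} (hb : sqNorm b = 1)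
    {α : (Fin n → ℂ) → ℂ} (hα : ContDiffOn ℝ 1 α D) (hαc : HasCompactSupport α)
    (hαs : tsupport α ⊆ D) :
    ∫ z, (f z * star (linForm b p z)) * (star (twistedDz u b α z) * exp (-((u z : ℝ) : ℂ))) =
      -∫ z, f z * (star (α z) * exp (-((u z : ℝ) : ℂ))) := by
  have hf1 : ContDiffOn ℝ 1 f D := by
    exact_mod_cast contDiffOn_real_of_differentiableOn hD hf 1
  have hl1 : ContDiffOn ℝ 1 (linForm b p) D := by
    exact_mod_cast contDiffOn_real_of_differentiableOn hD (differentiable_linForm b).differentiableOn 1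
  rw [integral_mul_star_twistedDz hD hu hα hαc hαs (hf1.mul (contDiffOn_star hl1))]
  congr 2
  ext z
  by_cases hz : z ∈ D
  · have hn := hD.mem_nhds hz
    have hlz : DifferentiableAt ℝ (linForm b p) z := (differentiable_linForm b z).restrictScalars ℝ
    rw [dirDzbar_mul ((hf.differentiableAt hn).restrictScalars ℝ) hlz.star,
      dirDzbar_eq_zero (hf.differentiableAt hn), dirDzbar_star hlz, dirDz_linForm]
    have : ∑ j, star (b j) * b j = 1 := by
      have := ofReal_sqNorm b
      rw [hb, ofReal_one] at this
      rw [this]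
      exact Finset.sum_congr rfl fun _ _ => mul_comm _ _
    rw [this]
    simp
  · simp [image_eq_zero_of_notMem_tsupport fun h => hz (hαs h)]

/-- The inequality obtained from the division estimates by letting the parameter of the tuple of
generators tend to zero: Hörmander's estimate for `∂̄v_l = f ∂̄⟨a_l, z⟩`, tested against `α`. -/
theorem SkodaDivision.limit_inequality (hdiv : SkodaDivision r D φ f) (hD : IsOpen D)
    (hφ : ContDiffOn ℝ 2 φ D) (hf : MemA2 D φ f)
    (ha : ∀ l m, ∑ j, star (a l j) * a m j = if l = m then 1 else 0) (hs : 0 < s)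
    {α : (Fin n → ℂ) → ℂ} (hα : ContDiffOn ℝ 2 α D) (hαc : HasCompactSupport α)
    (hαs : tsupport α ⊆ D) (t : ℝ) :
    2 * t * (r * (∫ z, f z * (star (α z) * exp (-((φ z + gaussWeight s p z : ℝ) : ℂ)))).re) -
      t ^ 2 * ∑ l, ∫ z, ‖twistedDz (fun z => φ z + gaussWeight s p z) (a l) α z‖ ^ 2 *
        Real.exp (-(φ z + gaussWeight s p z)) ≤
    r / s * ∫ z in D, ‖f z‖ ^ 2 * Real.exp (-(φ z + gaussWeight s p z)) := by
  have hΦ : ContDiffOn ℝ 2 (fun z => φ z + gaussWeight s p z) D :=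
    hφ.add contDiff_gaussWeight.contDiffOn
  have ha1 := sqNorm_eq_one ha
  have hF : ∀ l, Integrable fun z => (f z * star (linForm (a l) p z)) *
      (star (twistedDz (fun z => φ z + gaussWeight s p z) (a l) α z) *
          exp (-((φ z + gaussWeight s p z : ℝ) : ℂ))) := by
    intro l
    have hsub := tsupport_twistedDz_subset (u := fun z => φ z + gaussWeight s p z) (α := α) (a l)
    refine integrable_of_continuousOn_of_tsupport_subset (D := D) ?_ ?_ ?_
    · refine (hf.1.continuousOn.mul (continuous_star.comp
        (differentiable_linForm (a l)).continuous).continuousOn).mul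
        ((continuous_star.comp_continuousOn (contDiffOn_twistedDz hD hΦ hα (a l)).continuousOn).mul
        (contDiffOn_weight hΦ).continuousOn)
    · exact (hαc.mono' (subset_closure.trans ((tsupport_star_mul_subset _).trans hsub))).mul_left
    · exact (tsupport_mul_subset_right).trans ((tsupport_star_mul_subset _).trans (hsub.trans hαs))
  have hJ : ∀ l, Tendsto (fun c : ℝ => ∫ z, (1 / (sqNorm (fun i => linTuple c a p i z) : ℂ)) *
      ((f z * star (linForm (a l) p z)) *
        (star (twistedDz (fun z => φ z + gaussWeight s p z) (a l) α z) *
          exp (-((φ z + gaussWeight s p z : ℝ) : ℂ))))) (𝓝[>] 0)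
      (𝓝 (-∫ z, f z * (star (α z) * exp (-((φ z + gaussWeight s p z : ℝ) : ℂ))))) := by
    intro l
    rw [← integral_linForm_mul_star_twistedDz (p := p) hD (hΦ.of_le (by norm_num)) hf.1 (ha1 l)
      (hα.of_le (by norm_num)) hαc hαs]
    -- The factor `1/|g|²` is at most `1` and tends to `1` as `c → 0`.
    refine tendsto_integral_filter_of_dominated_convergence _ ?_ ?_ (hF l).norm ?_
    · refine Eventually.of_forall fun c => AEStronglyMeasurable.mul ?_ (hF l).1
      refine Continuous.aestronglyMeasurable ?_
      have hq1 := one_le_sqNorm_linTuple (c := c) (a := a) (p := p)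
      refine continuous_const.div (continuous_ofReal.comp ?_) fun z => ?_
      · unfold sqNorm
        exact continuous_finsetSum _ fun i _ => (differentiable_linTuple i).continuous.norm.pow 2
      · have : sqNorm (fun i => linTuple c a p i z) ≠ 0 := by linarith [hq1 z]
        exact_mod_cast this
    · refine Eventually.of_forall fun c => Eventually.of_forall fun z => ?_
      rw [norm_mul]
      refine mul_le_of_le_one_left (norm_nonneg _) ?_
      have hq1 := one_le_sqNorm_linTuple (c := c) (a := a) (p := p) z
      rw [norm_div, norm_one, norm_real, Real.norm_of_nonneg (by linarith)]
      exact (div_le_one (by linarith)).2 hq1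
    · refine Eventually.of_forall fun z => ?_
      have h1 : Tendsto (fun c : ℝ => (1 / (sqNorm (fun i => linTuple c a p i z) : ℂ)))
          (𝓝[>] 0) (𝓝 1) := by
        have : Tendsto (fun c : ℝ => 1 / (c ^ 2 * (∑ l, ‖linForm (a l) p z‖ ^ 2) + 1)) (𝓝 0)
            (𝓝 (1 / (0 ^ 2 * (∑ l, ‖linForm (a l) p z‖ ^ 2) + 1))) := by
          refine ContinuousAt.tendsto (x := (0 : ℝ)) ?_
          refine ContinuousAt.div (by fun_prop) (by fun_prop) (by simp)
        have h2 := (continuous_ofReal.tendsto _).comp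
          (this.mono_left (nhdsWithin_le_nhds (s := Set.Ioi 0)))
        simp only [sqNorm_linTuple]
        simpa [Function.comp_def] using h2
      simpa using h1.mul_const _
  have hκ : Tendsto (fun c : ℝ => r / (s - c ^ 2 * r)) (𝓝[>] 0) (𝓝 (r / s)) := by
    have : Tendsto (fun c : ℝ => r / (s - c ^ 2 * r)) (𝓝 0) (𝓝 (r / (s - 0 ^ 2 * r))) := by
      refine ContinuousAt.tendsto (x := (0 : ℝ)) ?_
      exact ContinuousAt.div (by fun_prop) (by fun_prop) (by simpa using hs.ne')
    have h2 := this.mono_left (nhdsWithin_le_nhds (s := Set.Ioi 0))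
    simpa using h2
  have hsmall : ∀ᶠ c : ℝ in 𝓝[>] 0, c ^ 2 * r < s := by
    have : Tendsto (fun c : ℝ => c ^ 2 * r) (𝓝[>] 0) (𝓝 (0 ^ 2 * r)) :=
      (Continuous.tendsto (by fun_prop) 0).mono_left nhdsWithin_le_nhds
    exact this.eventually_lt_const (by simpa using hs)
  have hlim := le_of_tendsto_of_tendsto
    (((tendsto_finsetSum Finset.univ fun l _ =>
      (continuous_re.tendsto _).comp (hJ l)).const_mul (-(2 * t))).sub_const
      (t ^ 2 * ∑ l, ∫ z, ‖twistedDz (fun z => φ z + gaussWeight s p z) (a l) α z‖ ^ 2 *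
        Real.exp (-(φ z + gaussWeight s p z))))
    (hκ.mul_const (∫ z in D, ‖f z‖ ^ 2 * Real.exp (-(φ z + gaussWeight s p z))))
    (by
      filter_upwards [hsmall, self_mem_nhdsWithin] with c hc hc0
      exact hdiv.test_inequality hD hφ hf ha (ne_of_gt hc0) hc hα hαc hαs t)
  refine le_trans (le_of_eq ?_) hlim
  simp only [neg_re, Finset.sum_const, Finset.card_univ, Fintype.card_fin, nsmul_eq_mul]
  ring

/-- The curvature inequality for a cut-off function `χ`, with the weight `s |z - p|²`. -/
theorem SkodaDivision.integral_cutoff_nonneg (hdiv : SkodaDivision r D φ f) (hD : IsOpen D)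
    (hφ : ContDiffOn ℝ 2 φ D) (hf : MemA2 D φ f)
    (ha : ∀ l m, ∑ j, star (a l j) * a m j = if l = m then 1 else 0) (hs : 0 < s)
    {χ : (Fin n → ℂ) → ℝ} (hχ : ContDiff ℝ 2 χ) (hχc : HasCompactSupport χ)
    (hχs : tsupport χ ⊆ D) :
    IntegrableOn (fun z => (r * s * (1 - χ z) ^ 2 + (∑ l, leviForm φ (a l) z) * χ z ^ 2 +
        ∑ l, ‖dirDzbar (a l) (fun w => (χ w : ℂ)) z‖ ^ 2) *
      (‖f z‖ ^ 2 * Real.exp (-(φ z + gaussWeight s p z)))) D ∧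
    0 ≤ ∫ z in D, (r * s * (1 - χ z) ^ 2 + (∑ l, leviForm φ (a l) z) * χ z ^ 2 +
        ∑ l, ‖dirDzbar (a l) (fun w => (χ w : ℂ)) z‖ ^ 2) *
      (‖f z‖ ^ 2 * Real.exp (-(φ z + gaussWeight s p z))) := by
  have hΦ : ContDiffOn ℝ 2 (fun z => φ z + gaussWeight s p z) D :=
    hφ.add contDiff_gaussWeight.contDiffOn
  have ha1 := sqNorm_eq_one ha
  set Φ : (Fin n → ℂ) → ℝ := fun z => φ z + gaussWeight s p z with hΦdef
  set N : (Fin n → ℂ) → ℝ := fun z => ‖f z‖ ^ 2 * Real.exp (-Φ z) with hNdef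
  have hN : IntegrableOn N D := hf.add_gaussWeight (p := p) hD hφ.continuousOn hs.le
  have hNc : ContinuousOn N D := (hf.1.continuousOn.norm.pow 2).mul hΦ.continuousOn.neg.rexp
  have hf2 : ContDiffOn ℝ 2 f D := by
    exact_mod_cast contDiffOn_real_of_differentiableOn hD hf.1 2
  have hχ' : ContDiffOn ℝ 2 (fun w => (χ w : ℂ)) D := contDiffOn_ofReal hχ.contDiffOn
  set α : (Fin n → ℂ) → ℂ := fun z => (χ z : ℂ) * f z with hαdef
  have hα : ContDiffOn ℝ 2 α D := hχ'.mul hf2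
  have hχt : tsupport (fun w => (χ w : ℂ)) ⊆ tsupport χ := by
    refine closure_mono fun z hz => ?_
    contrapose! hz
    simp [Function.notMem_support.1 hz]
  have hαt : tsupport α ⊆ tsupport χ := (tsupport_mul_subset_left).trans hχt
  have hαc : HasCompactSupport α := hχc.mono' (subset_closure.trans hαt)
  have hαs : tsupport α ⊆ D := hαt.trans hχs
  have hχ0 : ∀ z ∉ D, χ z = 0 := fun z hz => image_eq_zero_of_notMem_tsupport fun h => hz (hχs h)
  -- The value `t = 1/s` makes the terms of order `s` the perfect square `rs(1-χ)²`, which vanishes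
  -- where `χ = 1`.
  have hmain := hdiv.limit_inequality (p := p) hD hφ hf ha hs hα hαc hαs (1 / s)
  have e1 : (∫ z, f z * (star (α z) * exp (-((Φ z : ℝ) : ℂ)))).re = ∫ z in D, χ z * N z := by
    rw [setIntegral_eq_integral_of_forall_compl_eq_zero fun z hz => by simp [hχ0 z hz]]
    have : ∀ z, f z * (star (α z) * exp (-((Φ z : ℝ) : ℂ))) = ((χ z * N z : ℝ) : ℂ) := by
      intro z
      have h := mul_star_mul_weight (f z) (Φ z)
      simp only [hNdef, ofReal_mul (χ z), ← h]
      simp only [hαdef, star_mul', Complex.star_def, conj_ofReal]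
      ring
    simp only [this, integral_complex_ofReal, ofReal_re]
  have hLc : ∀ l, ContinuousOn (leviForm φ (a l)) D := fun l =>
    continuous_re.comp_continuousOn (contDiffOn_dirDz (k := 0) hD
      (contDiffOn_dirDzbar (k := 1) hD (contDiffOn_ofReal hφ) (by norm_num))
      (by norm_num)).continuousOn
  have hdc : ∀ l, ContinuousOn (dirDzbar (a l) (fun w => (χ w : ℂ))) D := fun l =>
    (contDiffOn_dirDzbar (k := 1) hD hχ' (by norm_num)).continuousOn
  have hK : IsCompact (tsupport χ) := hχc
  have hint : ∀ {F : (Fin n → ℂ) → ℝ}, ContinuousOn F D → (∀ z ∉ tsupport χ, F z = 0) →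
      IntegrableOn (fun z => F z * N z) D := by
    intro F hF hF0
    refine IntegrableOn.of_forall_sdiff_eq_zero (s := tsupport χ)
      (((hF.mul hNc).mono hχs).integrableOn_compact hK) hD.measurableSet fun z hz => ?_
    simp [hF0 z hz.2]
  have i1 : IntegrableOn (fun z => χ z * N z) D :=
    hint hχ.continuous.continuousOn fun z hz => image_eq_zero_of_notMem_tsupport hz
  have i2 : IntegrableOn (fun z => χ z ^ 2 * N z) D :=
    hint (hχ.continuous.pow 2).continuousOn fun z hz => by
      simp [image_eq_zero_of_notMem_tsupport hz]
  have i3 : ∀ l, IntegrableOn (fun z => (leviForm φ (a l) z * χ z ^ 2) * N z) D := fun l =>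
    hint ((hLc l).mul (hχ.continuous.pow 2).continuousOn) fun z hz => by
      simp [image_eq_zero_of_notMem_tsupport hz]
  have i4 : ∀ l, IntegrableOn
      (fun z => ‖dirDzbar (a l) (fun w => (χ w : ℂ)) z‖ ^ 2 * N z) D := fun l =>
    hint ((hdc l).norm.pow 2) fun z hz => by
      simp [dirDzbar_of_notMem_tsupport fun h => hz (hχt h)]
  -- Bochner–Kodaira for `α = χf`: the Gaussian adds `s` to the Levi form in a unit direction, and
  -- `∂̄(χf) = f ∂̄χ` since `f` is holomorphic.
  have e2 : ∀ l, ∫ z, ‖twistedDz Φ (a l) α z‖ ^ 2 * Real.exp (-Φ z) =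
      (∫ z in D, (leviForm φ (a l) z * χ z ^ 2) * N z) + s * (∫ z in D, χ z ^ 2 * N z) +
        ∫ z in D, ‖dirDzbar (a l) (fun w => (χ w : ℂ)) z‖ ^ 2 * N z := by
    intro l
    rw [integral_norm_twistedDz_sq hD hΦ hα hαc hαs, ← integral_const_mul,
      ← integral_add (i3 l) (i2.const_mul s)]
    congr 1
    · rw [← setIntegral_eq_integral_of_forall_compl_eq_zero (s := D)
        fun z hz => by simp [hαdef, hχ0 z hz]]
      refine setIntegral_congr_fun hD.measurableSet fun z hz => ?_
      have : leviForm Φ (a l) z = leviForm φ (a l) z + s := by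
        rw [hΦdef, leviForm_add_gaussWeight hD hφ hz, ha1, mul_one]
      simp only [this, hαdef, hNdef, norm_mul, norm_real, Real.norm_eq_abs, mul_pow, sq_abs]
      ring
    · rw [← setIntegral_eq_integral_of_forall_compl_eq_zero (s := D)
        fun z hz => by
          rw [dirDzbar_of_notMem_tsupport fun h => hz (hαs h)]; simp]
      refine setIntegral_congr_fun hD.measurableSet fun z hz => ?_
      have hn := hD.mem_nhds hz
      have : dirDzbar (a l) α z = dirDzbar (a l) (fun w => (χ w : ℂ)) z * f z := by
        rw [hαdef, dirDzbar_mul ((hχ'.differentiableOn (by norm_num)).differentiableAt hn)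
          ((hf.1.differentiableAt hn).restrictScalars ℝ),
          dirDzbar_eq_zero (hf.1.differentiableAt hn), mul_zero, add_zero]
      simp only [this, hNdef, norm_mul, mul_pow]
      ring
  change 2 * (1 / s) * (r * (∫ z, f z * (star (α z) * exp (-((Φ z : ℝ) : ℂ)))).re) -
    (1 / s) ^ 2 * ∑ l, ∫ z, ‖twistedDz Φ (a l) α z‖ ^ 2 * Real.exp (-Φ z) ≤
      r / s * ∫ z in D, N z at hmain
  rw [e1] at hmain
  simp only [e2, Finset.sum_add_distrib, Finset.sum_const, Finset.card_univ, Fintype.card_fin,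
    nsmul_eq_mul] at hmain
  have j1 := hN.const_mul (r * s)
  have j2 := i1.const_mul (2 * (r * s))
  have j3 := i2.const_mul (r * s)
  have j4 := integrable_finsetSum Finset.univ fun l _ => i3 l
  have j5 := integrable_finsetSum Finset.univ fun l _ => i4 l
  have k1 : IntegrableOn (fun z => r * s * N z - 2 * (r * s) * (χ z * N z)) D := j1.sub j2
  have k2 : IntegrableOn (fun z => r * s * N z - 2 * (r * s) * (χ z * N z) +
    r * s * (χ z ^ 2 * N z)) D := k1.add j3
  have k3 : IntegrableOn (fun z => r * s * N z - 2 * (r * s) * (χ z * N z) +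
    r * s * (χ z ^ 2 * N z) + ∑ l, leviForm φ (a l) z * χ z ^ 2 * N z) D := k2.add j4
  have hpt : (fun z => (r * s * (1 - χ z) ^ 2 + (∑ l, leviForm φ (a l) z) * χ z ^ 2 +
      ∑ l, ‖dirDzbar (a l) (fun w => (χ w : ℂ)) z‖ ^ 2) * N z) =
      fun z => (r * s * N z - 2 * (r * s) * (χ z * N z) +
        r * s * (χ z ^ 2 * N z) + ∑ l, leviForm φ (a l) z * χ z ^ 2 * N z) +
        ∑ l, ‖dirDzbar (a l) (fun w => (χ w : ℂ)) z‖ ^ 2 * N z := by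
    ext z
    simp only [← Finset.sum_mul]
    ring
  have hfinal : ∫ z in D, (r * s * (1 - χ z) ^ 2 + (∑ l, leviForm φ (a l) z) * χ z ^ 2 +
        ∑ l, ‖dirDzbar (a l) (fun w => (χ w : ℂ)) z‖ ^ 2) * N z =
      r * s * (∫ z in D, N z) - 2 * (r * s) * (∫ z in D, χ z * N z) +
        r * s * (∫ z in D, χ z ^ 2 * N z) +
        (∑ l, ∫ z in D, (leviForm φ (a l) z * χ z ^ 2) * N z) +
        ∑ l, ∫ z in D, ‖dirDzbar (a l) (fun w => (χ w : ℂ)) z‖ ^ 2 * N z := by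
    rw [← integral_finsetSum _ fun l _ => i3 l, ← integral_finsetSum _ fun l _ => i4 l, hpt]
    simp only [← integral_const_mul]
    rw [← integral_sub j1 j2, ← integral_add k1 j3, ← integral_add k2 j4, ← integral_add k3 j5]
  refine ⟨by rw [hpt]; exact k3.add j5, ?_⟩
  rw [hfinal]
  set A := ∫ z in D, N z
  set B := ∫ z in D, χ z * N z
  set C := ∫ z in D, χ z ^ 2 * N z
  set E := ∑ l, ∫ z in D, (leviForm φ (a l) z * χ z ^ 2) * N z
  set G := ∑ l, ∫ z in D, ‖dirDzbar (a l) (fun w => (χ w : ℂ)) z‖ ^ 2 * N z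
  have hs2 : 0 < s ^ 2 := by positivity
  have h3 := mul_le_mul_of_nonneg_left hmain hs2.le
  have h4 : s ^ 2 * (2 * (1 / s) * (r * B) - (1 / s) ^ 2 * (E + r * (s * C) + G)) =
      2 * (r * s) * B - (E + r * s * C + G) := by
    field_simp
  have h5 : s ^ 2 * (r / s * A) = r * s * A := by
    field_simp
  have h6 : s ^ 2 * (2 * (1 / s) * (r * B) - (1 / s) ^ 2 * (E + r * (s * C) + G)) ≤
      s ^ 2 * (r / s * A) := h3
  rw [h4, h5] at h6
  linarith

end Limit

/-! ### Concentration at a point as `s → ∞`. -/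

section Conclusion

open Filter Topology

variable {n r : ℕ} {D : Set (Fin n → ℂ)} {φ : (Fin n → ℂ) → ℝ} {f : (Fin n → ℂ) → ℂ}
  {a : Fin r → Fin n → ℂ} {p : Fin n → ℂ}

theorem isHermitian_complexHessian (hD : IsOpen D) (hφ : ContDiffOn ℝ 2 φ D) (hp : p ∈ D) :
    (complexHessian φ p).IsHermitian := by
  have hU := contDiffOn_ofReal hφ
  have hn := hD.mem_nhds hp
  ext j k
  rw [Matrix.conjTranspose_apply, complexHessian, Matrix.of_apply, Matrix.of_apply]
  have hz : ∀ m, dzbar m (fun w => (φ w : ℂ)) = dirDzbar (Pi.single m 1) (fun w => (φ w : ℂ)) :=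
    fun m => funext fun w => dzbar_eq_dirDzbar m
  rw [hz, hz, dz_eq_dirDz, dz_eq_dirDz, ← dirDzbar_star]
  · have h : (fun w => star (dirDzbar (Pi.single j 1) (fun w => (φ w : ℂ)) w)) =ᶠ[𝓝 p]
        dirDz (Pi.single j 1) (fun w => (φ w : ℂ)) := by
      filter_upwards [hn] with w hw
      rw [← star_dirDz_ofReal hD (hφ.of_le (by norm_num)) hw, star_star]
    rw [dirDzbar_congr h, dirDzbar_dirDz_comm (hU.contDiffAt hn)]
  · exact ((contDiffOn_dirDzbar (k := 1) hD hU (by norm_num)).differentiableOn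
      (by norm_num)).differentiableAt hn

/-- The Levi form pairs `a_j conj(a_k)` with the `(j,k)` entry, whereas `v^* H v` pairs `conj(v_j)
v_k` with it; hence the conjugated eigenvector. -/
theorem leviForm_star_eigenvectorBasis (hD : IsOpen D) (hφ : ContDiffOn ℝ 2 φ D) (hp : p ∈ D)
    (hH : (complexHessian φ p).IsHermitian) (i : Fin n) :
    leviForm φ (fun j => star (hH.eigenvectorBasis i j)) p = hH.eigenvalues i := by
  rw [leviForm, dirDz_dirDzbar_eq_sum ((contDiffOn_ofReal hφ).contDiffAt (hD.mem_nhds hp)),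
    hH.eigenvalues_eq]
  simp only [RCLike.re_eq_complex_re]
  congr 1
  simp only [dotProduct, Matrix.mulVec, Pi.star_apply, Finset.mul_sum, complexHessian,
    Matrix.of_apply, star_star]
  exact Finset.sum_congr rfl fun j _ => Finset.sum_congr rfl fun k _ => by ring

/-- The distance on `Fin n → ℂ` comes from the sup norm, while the Gaussian uses the Euclidean one.
This bound and `sqNorm_sub_le` compare them. -/
theorem sq_dist_le_sqNorm_sub (z : Fin n → ℂ) {ρ : ℝ} (hρ : 0 ≤ ρ) (h : ρ ≤ dist z p) :
    ρ ^ 2 ≤ sqNorm (fun j => z j - p j) := by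
  have h1 : ‖z - p‖ ≤ √(sqNorm fun j => z j - p j) := by
    refine (pi_norm_le_iff_of_nonneg (Real.sqrt_nonneg _)).2 fun j => ?_
    refine Real.le_sqrt_of_sq_le ?_
    exact Finset.single_le_sum (f := fun j => ‖z j - p j‖ ^ 2) (fun _ _ => by positivity)
      (Finset.mem_univ j)
  rw [dist_eq_norm] at h
  calc ρ ^ 2 ≤ (√(sqNorm fun j => z j - p j)) ^ 2 := by gcongr; exact h.trans h1
    _ = _ := Real.sq_sqrt (sqNorm_nonneg _)

theorem sqNorm_sub_le (z : Fin n → ℂ) {τ : ℝ} (h : dist z p ≤ τ) :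
    sqNorm (fun j => z j - p j) ≤ n * τ ^ 2 := by
  rw [dist_eq_norm] at h
  calc sqNorm (fun j => z j - p j) ≤ ∑ _j : Fin n, τ ^ 2 := by
        refine Finset.sum_le_sum fun j _ => ?_
        gcongr
        exact (norm_le_pi_norm (z - p) j).trans h
    _ = _ := by simp

/-- The Gaussian mass of a nonzero holomorphic function near a point is positive. -/
theorem MemA2.setIntegral_ball_pos (hD : IsOpen D) (hDc : IsPreconnected D)
    (hφ : ContinuousOn φ D) (hf : MemA2 D φ f) (hf0 : ∃ z ∈ D, f z ≠ 0) {τ : ℝ} (hτ : 0 < τ)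
    (hp : p ∈ D) (hτD : Metric.ball p τ ⊆ D) :
    0 < ∫ z in Metric.ball p τ, ‖f z‖ ^ 2 * Real.exp (-φ z) := by
  refine lt_of_le_of_ne (integral_nonneg fun z => by positivity) fun h0 => ?_
  have hint := (hf.integrableOn hD hφ).mono_set hτD
  have h1 := (integral_eq_zero_iff_of_nonneg (fun z => by positivity) hint).1 h0.symm
  have h2 := Measure.eqOn_open_of_ae_eq h1 Metric.isOpen_ball
    (((hf.1.continuousOn.norm.pow 2).mul hφ.neg.rexp).mono hτD) continuousOn_const
  obtain ⟨z, hz, hfz⟩ := hf0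
  refine hfz (eqOn_zero_of_eventuallyEq_zero hD hDc hf.1 hp ?_ hz)
  filter_upwards [Metric.ball_mem_nhds p hτ] with w hw
  have := h2 hw
  simpa [Real.exp_ne_zero] using this

theorem tendsto_linear_mul_exp_neg (A C b : ℝ) (hb : 0 < b) :
    Tendsto (fun s : ℝ => (A * s + C) * Real.exp (-(s * b))) atTop (𝓝 0) := by
  have h1 := (Real.tendsto_pow_mul_exp_neg_atTop_nhds_zero 1).comp
    (tendsto_id.atTop_mul_const hb)
  have h0 := (Real.tendsto_pow_mul_exp_neg_atTop_nhds_zero 0).comp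
    (tendsto_id.atTop_mul_const hb)
  have := (h1.const_mul (A / b)).add (h0.const_mul C)
  simp only [mul_zero, add_zero] at this
  refine this.congr fun s => ?_
  simp only [Function.comp, id, pow_one, pow_zero]
  field_simp

/-- The division property forces the sum of the Levi form over an orthonormal `r`-frame to be
non-negative. -/
theorem SkodaDivision.sum_leviForm_nonneg (hdiv : SkodaDivision r D φ f) (hD : IsOpen D)
    (hDc : IsPreconnected D) (hφ : ContDiffOn ℝ 2 φ D) (hf : MemA2 D φ f)
    (hf0 : ∃ z ∈ D, f z ≠ 0)
    (ha : ∀ l m, ∑ j, star (a l j) * a m j = if l = m then 1 else 0) (hp : p ∈ D) :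
    0 ≤ ∑ l, leviForm φ (a l) p := by
  by_contra! hneg
  have hLc : ContinuousOn (fun z => ∑ l, leviForm φ (a l) z) D :=
    continuousOn_finsetSum _ fun l _ =>
      continuous_re.comp_continuousOn (contDiffOn_dirDz (k := 0) hD
        (contDiffOn_dirDzbar (k := 1) hD (contDiffOn_ofReal hφ) (by norm_num))
        (by norm_num)).continuousOn
  obtain ⟨κ, hκ0, hκ⟩ : ∃ κ : ℝ, 0 < κ ∧ ∑ l, leviForm φ (a l) p < -κ :=
    ⟨-(∑ l, leviForm φ (a l) p) / 2, by linarith, by linarith⟩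
  have hnear : ∀ᶠ z in 𝓝 p, z ∈ D ∧ ∑ l, leviForm φ (a l) z < -κ :=
    Filter.Eventually.and (hD.mem_nhds hp)
      ((hLc.continuousAt (hD.mem_nhds hp)).eventually_lt_const hκ)
  obtain ⟨ε, hε, hball⟩ := Metric.nhds_basis_closedBall.eventually_iff.1 hnear
  set ρ := ε / 2 with hρdef
  have hρ : 0 < ρ := by positivity
  let χ : ContDiffBump p := ⟨ρ, ε, hρ, by linarith⟩
  have hχ : ContDiff ℝ 2 χ := χ.contDiff
  have hχt : tsupport χ = Metric.closedBall p ε := χ.tsupport_eq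
  have hχD : tsupport χ ⊆ D := by
    rw [hχt]; exact fun z hz => (hball hz).1
  have hχC : ContDiffOn ℝ 2 (fun w => ((χ w : ℝ) : ℂ)) Set.univ := contDiffOn_ofReal hχ.contDiffOn
  set T : (Fin n → ℂ) → ℝ := fun z => ∑ l, ‖dirDzbar (a l) (fun w => ((χ w : ℝ) : ℂ)) z‖ ^ 2
  have hTc : Continuous T := continuous_finsetSum _ fun l _ => by
    have := (contDiffOn_dirDzbar (a := a l) (k := 1) isOpen_univ hχC (by norm_num)).continuousOn
    exact (continuousOn_univ.1 this).norm.pow 2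
  have hχt' : tsupport (fun w => ((χ w : ℝ) : ℂ)) ⊆ tsupport χ := by
    refine closure_mono fun z hz => ?_
    contrapose! hz
    simp [Function.notMem_support.1 hz]
  obtain ⟨C, hC⟩ : ∃ C, ∀ z, T z ≤ C := by
    obtain ⟨C, hC⟩ := (isCompact_closedBall p ε).exists_bound_of_continuousOn hTc.continuousOn
    refine ⟨max C 0, fun z => ?_⟩
    by_cases hz : z ∈ Metric.closedBall p ε
    · exact ((Real.le_norm_self _).trans (hC z hz)).trans (le_max_left _ _)
    · have : T z = 0 := Finset.sum_eq_zero fun l _ => by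
        rw [dirDzbar_of_notMem_tsupport fun h => hz (hχt ▸ hχt' h)]; simp
      rw [this]
      exact le_max_right _ _
  have hC0 : 0 ≤ C := (Finset.sum_nonneg fun _ _ => by positivity).trans (hC p)
  have hT0 : ∀ z ∈ Metric.ball p ρ, T z = 0 := by
    intro z hz
    refine Finset.sum_eq_zero fun l _ => ?_
    have : (fun w => ((χ w : ℝ) : ℂ)) =ᶠ[𝓝 z] fun _ => 1 := by
      filter_upwards [Metric.isOpen_ball.mem_nhds hz] with w hw
      rw [χ.one_of_mem_closedBall (Metric.ball_subset_closedBall hw), ofReal_one]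
    rw [dirDzbar_congr this]
    simp [dirDzbar]
  -- On the ball of radius `τ` the Gaussian exponent is at most `sρ²/2`, against at least `sρ²`
  -- outside the ball of radius `ρ`. The factor `n` pays for the sup norm.
  obtain ⟨τ, hτ, hτρ, hτn⟩ : ∃ τ : ℝ, 0 < τ ∧ τ < ρ ∧ n * τ ^ 2 ≤ ρ ^ 2 / 2 := by
    refine ⟨ρ / (2 * (n + 1)), by positivity, ?_, ?_⟩
    · rw [div_lt_iff₀ (by positivity)]
      nlinarith [(Nat.cast_nonneg n : (0 : ℝ) ≤ n)]
    · rw [div_pow, mul_div_assoc', div_le_div_iff₀ (by positivity) (by positivity)]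
      have hn : (0 : ℝ) ≤ n := Nat.cast_nonneg n
      have hρ2 : 0 ≤ ρ ^ 2 := by positivity
      nlinarith [mul_nonneg hρ2 hn, mul_nonneg hρ2 (mul_nonneg hn hn)]
  have hτD : Metric.ball p τ ⊆ D := fun z hz => (hball (Metric.closedBall_subset_closedBall
    (by linarith) (Metric.ball_subset_closedBall hz))).1
  set N : (Fin n → ℂ) → ℝ := fun z => ‖f z‖ ^ 2 * Real.exp (-φ z) with hN
  have hNint : IntegrableOn N D := hf.integrableOn hD hφ.continuousOn
  have hm := hf.setIntegral_ball_pos hD hDc hφ.continuousOn hf0 hτ hp hτD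
  set m := ∫ z in Metric.ball p τ, N z
  set M := ∫ z in D, N z
  -- Inside the `ρ`-ball only the negative Levi term survives, and it is kept on the `τ`-ball alone.
  -- Outside, the Levi term is dropped and the rest is at most `(rs + C) e^{-sρ²}` times the
  -- `φ`-weighted density of `f`.
  have key : ∀ s : ℝ, 0 < s →
      κ * m ≤ (r * s + C) * Real.exp (-(s * (ρ ^ 2 / 2))) * M := by
    intro s hs
    obtain ⟨hint, hnn⟩ := hdiv.integral_cutoff_nonneg (p := p) hD hφ hf ha hs hχ
      χ.hasCompactSupport hχD
    have hind : IntegrableOn ((Metric.ball p τ).indicator N) D :=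
      hNint.indicator Metric.isOpen_ball.measurableSet
    have hmono := setIntegral_mono_on hint ((hNint.const_mul
      ((r * s + C) * Real.exp (-(s * ρ ^ 2)))).sub (hind.const_mul
        (κ * Real.exp (-(s * (ρ ^ 2 / 2)))))) hD.measurableSet (fun z hz => by
      have hsplit : ‖f z‖ ^ 2 * Real.exp (-(φ z + gaussWeight s p z)) =
          N z * Real.exp (-gaussWeight s p z) := by
        rw [neg_add, Real.exp_add, hN]; ring
      have hN0 : 0 ≤ N z := by positivity
      have hG0 := (Real.exp_pos (-gaussWeight s p z)).le
      change (r * s * (1 - χ z) ^ 2 + (∑ l, leviForm φ (a l) z) * χ z ^ 2 + T z) * _ ≤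
        (r * s + C) * Real.exp (-(s * ρ ^ 2)) * N z -
          κ * Real.exp (-(s * (ρ ^ 2 / 2))) * (Metric.ball p τ).indicator N z
      rw [hsplit]
      by_cases hzρ : z ∈ Metric.ball p ρ
      · have h1 : χ z = 1 := χ.one_of_mem_closedBall (Metric.ball_subset_closedBall hzρ)
        have h2 : ∑ l, leviForm φ (a l) z < -κ := (hball (Metric.closedBall_subset_closedBall
          (by linarith) (Metric.ball_subset_closedBall hzρ))).2
        rw [h1, hT0 z hzρ]
        have h3 : 0 ≤ (r * s + C) * Real.exp (-(s * ρ ^ 2)) * N z := by positivity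
        have h4 : κ * Real.exp (-(s * (ρ ^ 2 / 2))) * (Metric.ball p τ).indicator N z ≤
            κ * (N z * Real.exp (-gaussWeight s p z)) := by
          by_cases hzτ : z ∈ Metric.ball p τ
          · rw [Set.indicator_of_mem hzτ, mul_assoc]
            gcongr ?_ * ?_
            rw [mul_comm]
            gcongr
            rw [gaussWeight]
            gcongr
            exact (sqNorm_sub_le z (Metric.mem_ball.1 hzτ).le).trans hτn
          · rw [Set.indicator_of_notMem hzτ, mul_zero]
            positivity
        have h5 : (∑ l, leviForm φ (a l) z) * (N z * Real.exp (-gaussWeight s p z)) ≤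
            -κ * (N z * Real.exp (-gaussWeight s p z)) :=
          mul_le_mul_of_nonneg_right h2.le (by positivity)
        calc _ = (∑ l, leviForm φ (a l) z) * (N z * Real.exp (-gaussWeight s p z)) := by ring
          _ ≤ _ := by linarith
      · have hzτ : z ∉ Metric.ball p τ := fun h => hzρ (Metric.ball_subset_ball hτρ.le h)
        rw [Set.indicator_of_notMem hzτ, mul_zero, sub_zero]
        have h1 : (∑ l, leviForm φ (a l) z) * χ z ^ 2 ≤ 0 := by
          by_cases hzε : z ∈ Metric.closedBall p ε
          · exact mul_nonpos_of_nonpos_of_nonneg (by linarith [(hball hzε).2]) (by positivity)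
          · have : χ z = 0 := image_eq_zero_of_notMem_tsupport (hχt ▸ hzε)
            rw [this]; simp
        have h2 : r * s * (1 - χ z) ^ 2 ≤ r * s := by
          refine mul_le_of_le_one_right (by positivity) ?_
          have := χ.nonneg (x := z)
          have := χ.le_one (x := z)
          nlinarith
        have h3 : Real.exp (-gaussWeight s p z) ≤ Real.exp (-(s * ρ ^ 2)) := by
          rw [gaussWeight]
          gcongr
          exact sq_dist_le_sqNorm_sub z hρ.le (by simpa using hzρ)
        calc _ ≤ (r * s + C) * (N z * Real.exp (-gaussWeight s p z)) := by
              refine mul_le_mul_of_nonneg_right ?_ (by positivity)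
              linarith [hC z]
          _ ≤ (r * s + C) * (N z * Real.exp (-(s * ρ ^ 2))) := by gcongr
          _ = _ := by ring)
    have heq : ∫ z in D, ((fun z => (r * s + C) * Real.exp (-(s * ρ ^ 2)) * N z) -
        fun z => κ * Real.exp (-(s * (ρ ^ 2 / 2))) * (Metric.ball p τ).indicator N z) z =
        (r * s + C) * Real.exp (-(s * ρ ^ 2)) * M - κ * Real.exp (-(s * (ρ ^ 2 / 2))) * m := by
      rw [integral_sub' (hNint.const_mul _) (hind.const_mul _), integral_const_mul,
        integral_const_mul, setIntegral_indicator Metric.isOpen_ball.measurableSet,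
        Set.inter_eq_right.2 hτD]
    have h1 := (hnn.trans hmono).trans_eq heq
    have h2 : Real.exp (-(s * ρ ^ 2)) =
        Real.exp (-(s * (ρ ^ 2 / 2))) * Real.exp (-(s * (ρ ^ 2 / 2))) := by
      rw [← Real.exp_add]; congr 1; ring
    rw [h2] at h1
    have h3 := Real.exp_pos (-(s * (ρ ^ 2 / 2)))
    refine le_of_mul_le_mul_left ?_ h3
    linarith
  have hlim := (tendsto_linear_mul_exp_neg r C (ρ ^ 2 / 2) (by positivity)).mul_const M
  rw [zero_mul] at hlim
  -- Letting `s → ∞` gives `κ m ≤ 0`, although both factors are positive.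
  have := ge_of_tendsto hlim ((eventually_gt_atTop 0).mono key)
  nlinarith [mul_pos hκ0 hm]

end Conclusion

end SkodaConverse

end

/-! ### The theorem, by diagonalising the Hessian at each point. -/

theorem mainTheorem1 (n r : ℕ) (hr1 : 1 ≤ r) (hrn : r ≤ n)
    (D : Set (Fin n → ℂ)) (hDo : IsOpen D) (hDc : IsConnected D) (hDb : Bornology.IsBounded D)
    (φ : (Fin n → ℂ) → ℝ) (hφ : ContDiffOn ℝ 2 φ D)
    (f : (Fin n → ℂ) → ℂ) (hf : SkodaConverse.MemA2 D φ f) (hf0 : ∃ z ∈ D, f z ≠ 0)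
    (hdiv : ∀ (g : Fin (r + 1) → (Fin n → ℂ) → ℂ) (ψ : (Fin n → ℂ) → ℝ),
      (∀ i, DifferentiableOn ℂ (g i) D) →
      (∀ z ∈ D, ∃ i, g i z ≠ 0) →
      (∀ z ∈ D, ∃ v : Fin r → Fin n → ℂ,
        SkodaConverse.wedgeD (fun i : Fin r => g i.castSucc) z v ≠ 0) →
      ContDiffOn ℝ ∞ ψ D →
      SkodaConverse.PSH D ψ →
      (∀ z ∈ D, SkodaConverse.NakanoPositive (SkodaConverse.curv ψ g z)) →
      SkodaConverse.skodaI D φ ψ g f < ⊤ →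
      ∃ h : Fin (r + 1) → (Fin n → ℂ) → ℂ,
        (∀ i, DifferentiableOn ℂ (h i) D) ∧
        (∀ z ∈ D, f z = ∑ i, g i z * h i z) ∧
        SkodaConverse.normSq D (fun z => φ z + ψ z) h ≤ SkodaConverse.skodaI D φ ψ g f) :
    ∀ z ∈ D, ∃ hH : (SkodaConverse.complexHessian φ z).IsHermitian,
      ∀ s : Finset (Fin n), s.card = r → 0 ≤ ∑ i ∈ s, hH.eigenvalues i := by
  intro z hz
  have hH := SkodaConverse.isHermitian_complexHessian hDo hφ hz
  refine ⟨hH, fun s hs => ?_⟩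
  have hS : SkodaConverse.SkodaDivision r D φ f := hdiv
  let e : Fin r ≃ s := (s.equivFinOfCardEq hs).symm
  -- Conjugating all the vectors of an orthonormal family preserves orthonormality; it swaps the two
  -- arguments of the inner product.
  have ha : ∀ l m : Fin r, ∑ j, star (star (hH.eigenvectorBasis (e l) j)) *
      star (hH.eigenvectorBasis (e m) j) = if l = m then 1 else 0 := by
    intro l m
    have h := orthonormal_iff_ite.1 hH.eigenvectorBasis.orthonormal (e m) (e l)
    have h1 : ((e m : Fin n) = e l) ↔ l = m := by
      rw [Subtype.coe_inj, e.injective.eq_iff, eq_comm]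
    simp only [h1] at h
    rw [← h, PiLp.inner_apply]
    simp
  have hmain := hS.sum_leviForm_nonneg hDo hDc.isPreconnected hφ hf hf0 ha hz
  simp only [SkodaConverse.leviForm_star_eigenvectorBasis hDo hφ hz hH] at hmain
  rw [e.sum_comp (fun i : s => hH.eigenvalues i)] at hmain
  rwa [Finset.sum_coe_sort s (fun i => hH.eigenvalues i)] at hmain
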